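/- Let $k$ be a field of characteristic $0$, let $\mathcal{C}$ be a category with finite products, and let $H^{\bullet} : \mathcal{C}^{\mathrm{op}} \to \mathrm{GrVec}_{k}$ be a functor to the category of $\mathbb{Z}_{\geq 0}$-graded $k$-vector spaces and $k$-linear maps of degree $0$, with $H^{\bullet}(Y) \neq 0$ for at least one object $Y$. Assume: 1. (Cup product) for every object $X$ there are $k$-bilinear maps $\cup : H^{i}(X) \times H^{j}(X) \to H^{i+j}(X)$ $(i, j \geq 0)$ with $a \cup b = (-1)^{ij}\, b \cup a$ for $a \in H^{i}(X)$, $b \in H^{j}(X)$; they are associative, and natural in $X$, that is, $f^{*}(a \cup b) = f^{*}(a) \cup f^{*}(b)$ for every morphism $f$ of $\mathcal{C}$; 2. (Künneth formula) for all objects $X, Y$ there is a $k$-linear isomorphism $H^{\bullet}(X \times Y) \simeq H^{\bullet}(X) \otimes_{k} H^{\bullet}(Y)$ that sends $p_{X}^{*}(a) \cup p_{Y}^{*}(b)$ to $a \otimes b$ for all homogeneous $a \in H^{\bullet}(X)$, $b \in H^{\bullet}(Y)$, where $p_X, p_Y$ are the projections; 3. $\dim_{k} H^{i}(X) < \infty$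 for every object $X$ and every $i \geq 0$. Let $X$ be an object of $\mathcal{C}$ such that $\dim_{k} H^{\bullet}(X)$ is finite, and let $\phi = \bigoplus_{i} \phi_{i}$ be a $k$-linear graded endomorphism (of degree $0$) of $H^{\bullet}(X)$. Let $p_1, \dots, p_n : X^n \to X$ be the projections, and let $S_{n}$ act on $H^{\bullet}(X^{n})$ by $g \mapsto \tilde g^{*}$, where $\tilde g : X^{n} \to X^{n}$ is the morphism with $p_{j} \circ \tilde g = p_{g(j)}$ for all $j$. Then for every $n \geq 0$ there is exactly one $k$-linear graded endomorphism $\phi_{X^{n}}$ of $H^{\bullet}(X^{n})$ such that $$\phi_{X^{n}}\bigl(p_{1}^{*}(a_{1}) \cup \cdots \cup p_{n}^{*}(a_{n})\bigr) = p_{1}^{*}(\phi(a_{1})) \cup \cdots \cup p_{n}^{*}(\phi(a_{n}))$$ for all homogeneous $a_{1}, \dots, a_{n} \in H^{\bullet}(X)$ (for $n = 0$ this is read as $\phi_{X^{0}} = \mathrm{id}$), and it maps the $S_n$-invariants $H^{\bullet}(X^{n})^{S_{n}}$ to themselves. For a graded endomorphism $\psi = \bigoplus_i \psi_i$ of a graded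 vector space with finite-dimensional homogeneous parts put $L_{u}(\psi) := \sum_{i \geq 0} (-u)^{i}\, \mathrm{Tr}(\psi_{i}) \in k[[u]]$. There is an integer $d \geq 0$ with $H^{i}(X) = 0$ for all $i > 2d$, and for every such $d$, in $k[[u]][[t]]$, $$\sum_{n=0}^{\infty} L_{u}\bigl(\phi_{X^{n}}|_{H^{\bullet}(X^{n})^{S_{n}}}\bigr)\, t^{n} = \prod_{i=0}^{2d} \det\bigl(\mathrm{id}_{H^{i}(X)} - \phi_{i} u^{i} t\bigr)^{(-1)^{i+1}}.$$ In particular, this generating function is rational in $t$: it equals $P/Q$ for some $P, Q \in k[u][t]$ such that $Q$ has constant term $1$ in $t$. -/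

import Mathlib

open CategoryTheory CategoryTheory.Limits Opposite
open scoped DirectSum TensorProduct

universe u v w x

noncomputable section

namespace GradedCohomology

section Graded

variable {k : Type u} [Field k]

/-- The `ℕ`-graded vector spaces over `k`, with the `k`-linear maps of degree `0` as morphisms. -/
abbrev GrVec (k : Type u) [Field k] := GradedObject ℕ (ModuleCat.{x} k)

/-- The total space `⨁ i, V i` of a graded vector space. -/
abbrev TotalSpace (V : GrVec.{u, x} k) : Type x := ⨁ i : ℕ, (V i : Type x)

/-- A homogeneous element of degree `i`, seen in the total space. -/
abbrev homog {V : GrVec.{u, x} k} (i : ℕ) : (V i : Type x) →ₗ[k] TotalSpace V :=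
  DirectSum.lof k ℕ (fun i => (V i : Type x)) i

/-- The linear map of total spaces given by a graded map. -/
def totalMap {V W : GrVec.{u, x} k} (f : V ⟶ W) : TotalSpace V →ₗ[k] TotalSpace W :=
  DirectSum.lmap fun i => (f i).hom

/-- The Lefschetz series `∑ i, (-u) ^ i * Tr (ψ i)`, a power series in `u`. -/
def lefschetz {V : ℕ → Type x} [∀ i, AddCommGroup (V i)] [∀ i, Module k (V i)]
    (ψ : ∀ i, V i →ₗ[k] V i) : PowerSeries k :=
  PowerSeries.mk fun i => (-1) ^ i * LinearMap.trace k (V i) (ψ i)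

/-- `det (id - r ψ)` for `r` in a commutative `k`-algebra `R`: the determinant of the endomorphism
`id - r ψ` of the free `R`-module `R ⊗ V` obtained from `V` by extension of scalars. -/
def detOneSub {R : Type u} [CommRing R] [Algebra k R] {V : Type x} [AddCommGroup V] [Module k V]
    (r : R) (ψ : V →ₗ[k] V) : R :=
  LinearMap.det (LinearMap.id - r • ψ.baseChange R)

/-- `det (id - ψ u ^ i t)`, as an element of `k[u][t]`: the inner polynomial variable is `u`, the
outer one is `t`. -/
def detFactor {V : Type x} [AddCommGroup V] [Module k V] (i : ℕ) (ψ : V →ₗ[k] V) :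
    Polynomial (Polynomial k) :=
  detOneSub (Polynomial.C ((Polynomial.X : Polynomial k) ^ i) * Polynomial.X) ψ

/-- The inclusion of `k[u][t]` into `k⟦u⟧⟦t⟧`. -/
def toSeries (k : Type u) [Field k] :
    Polynomial (Polynomial k) →+* PowerSeries (PowerSeries k) :=
  Polynomial.coeToPowerSeries.ringHom.comp
    (Polynomial.mapRingHom Polynomial.coeToPowerSeries.ringHom)

end Graded

variable {C : Type v} [Category.{w} C] {k : Type u} [Field k]

/-- The pullback `f^* : H^i(Y) → H^i(X)`. -/
abbrev pullback (H : Cᵒᵖ ⥤ GrVec.{u, x} k) {X Y : C} (f : X ⟶ Y) (i : ℕ) :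
    (H.obj (op Y) i : Type x) →ₗ[k] (H.obj (op X) i : Type x) :=
  (H.map f.op i).hom

/-- A cup product on `H`: bilinear maps `H^i(X) × H^j(X) → H^(i+j)(X)`, graded commutative,
associative and natural in `X`. Equalities between elements whose degrees agree only
propositionally are stated in the total space. -/
structure CupProduct (H : Cᵒᵖ ⥤ GrVec.{u, x} k) where
  cup : ∀ (X : C) (i j : ℕ), (H.obj (op X) i : Type x) →ₗ[k]
    (H.obj (op X) j : Type x) →ₗ[k] (H.obj (op X) (i + j) : Type x)
  comm : ∀ (X : C) (i j : ℕ) (a : H.obj (op X) i) (b : H.obj (op X) j),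
    homog (V := H.obj (op X)) (i + j) (cup X i j a b) =
      (-1 : k) ^ (i * j) • homog (V := H.obj (op X)) (j + i) (cup X j i b a)
  assoc : ∀ (X : C) (i j l : ℕ) (a : H.obj (op X) i) (b : H.obj (op X) j) (c : H.obj (op X) l),
    homog (V := H.obj (op X)) (i + j + l) (cup X (i + j) l (cup X i j a b) c) =
      homog (V := H.obj (op X)) (i + (j + l)) (cup X i (j + l) a (cup X j l b c))
  natural : ∀ {X Y : C} (f : X ⟶ Y) (i j : ℕ) (a : H.obj (op Y) i) (b : H.obj (op Y) j),
    pullback H f (i + j) (cup Y i j a b) = cup X i j (pullback H f i a) (pullback H f j b)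

/-- The cup product extended bilinearly to the total space `H^•(X)`. -/
def CupProduct.total {H : Cᵒᵖ ⥤ GrVec.{u, x} k} (μ : CupProduct H) (X : C) :
    TotalSpace (H.obj (op X)) →ₗ[k] TotalSpace (H.obj (op X)) →ₗ[k] TotalSpace (H.obj (op X)) :=
  DirectSum.toModule k ℕ _ fun i =>
    (DirectSum.toModule k ℕ _ fun j =>
      ((μ.cup X i j).compr₂ (homog (V := H.obj (op X)) (i + j))).flip).flip

/-- The iterated cup product `a 0 ∪ a 1 ∪ ⋯ ∪ a n`, bracketed from the left. -/
def CupProduct.iter {H : Cᵒᵖ ⥤ GrVec.{u, x} k} (μ : CupProduct H) (X : C) :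
    ∀ n : ℕ, (Fin (n + 1) → TotalSpace (H.obj (op X))) → TotalSpace (H.obj (op X))
  | 0, a => a 0
  | n + 1, a => μ.total X (CupProduct.iter μ X n fun j => a j.castSucc) (a (Fin.last (n + 1)))

variable [HasFiniteProducts C]

/-- The Künneth formula: for all `X` and `Y` there is a linear isomorphism
`H^•(X × Y) ≃ H^•(X) ⊗ H^•(Y)` that sends `p_X^*(a) ∪ p_Y^*(b)` to `a ⊗ b` for all homogeneous `a`
and `b`. -/
def CupProduct.Kunneth {H : Cᵒᵖ ⥤ GrVec.{u, x} k} (μ : CupProduct H) : Prop :=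
  ∀ X Y : C, ∃ e : TotalSpace (H.obj (op (X ⨯ Y))) ≃ₗ[k]
      TotalSpace (H.obj (op X)) ⊗[k] TotalSpace (H.obj (op Y)),
    ∀ (i j : ℕ) (a : H.obj (op X) i) (b : H.obj (op Y) j),
      e (homog (V := H.obj (op (X ⨯ Y))) (i + j) (μ.cup (X ⨯ Y) i j
          (pullback H (prod.fst : X ⨯ Y ⟶ X) i a) (pullback H (prod.snd : X ⨯ Y ⟶ Y) j b))) =
        homog (V := H.obj (op X)) i a ⊗ₜ[k] homog (V := H.obj (op Y)) j b

/-- The power `X ^ n`; `X ^ 0` is a terminal object. -/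
abbrev power (X : C) (n : ℕ) : C := ∏ᶜ fun _ : Fin n => X

/-- The projection `p_j : X ^ n ⟶ X`. -/
abbrev proj (X : C) (n : ℕ) (j : Fin n) : power X n ⟶ X := Pi.π (fun _ : Fin n => X) j

/-- The permutation of coordinates with `p_j ∘ permute σ = p_(σ j)`. -/
def permute (X : C) (n : ℕ) (σ : Equiv.Perm (Fin n)) : power X n ⟶ power X n :=
  Pi.lift fun j => proj X n (σ j)

theorem permute_one (X : C) (n : ℕ) : permute X n 1 = 𝟙 (power X n) := by
  apply Pi.hom_ext
  intro j
  simp [permute]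

theorem permute_mul (X : C) (n : ℕ) (σ τ : Equiv.Perm (Fin n)) :
    permute X n (σ * τ) = permute X n σ ≫ permute X n τ := by
  apply Pi.hom_ext
  intro j
  simp [permute]

/-- The action of the symmetric group on `H^i(X ^ n)`, in which `σ` acts by the pullback along
`permute X n σ`. -/
def permRep (H : Cᵒᵖ ⥤ GrVec.{u, x} k) (X : C) (n i : ℕ) :
    Representation k (Equiv.Perm (Fin n)) (H.obj (op (power X n)) i) where
  toFun σ := pullback H (permute X n σ) i
  map_one' := by
    simp only [pullback, permute_one, op_id, H.map_id]
    rfl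
  map_mul' σ τ := by
    simp only [pullback, permute_mul, op_comp, H.map_comp]
    rfl

/-- `Φ` is the graded endomorphism of `H^•(X ^ n)` induced by the graded endomorphism `φ` of
`H^•(X)`: it sends `p_1^*(a_1) ∪ ⋯ ∪ p_n^*(a_n)` to `p_1^*(φ a_1) ∪ ⋯ ∪ p_n^*(φ a_n)` for all
homogeneous `a_1, …, a_n`. For `n = 0` (no factors) it is the identity. -/
def CupProduct.IsInduced {H : Cᵒᵖ ⥤ GrVec.{u, x} k} (μ : CupProduct H) {X : C}
    (φ : H.obj (op X) ⟶ H.obj (op X)) :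
    ∀ n : ℕ, (H.obj (op (power X n)) ⟶ H.obj (op (power X n))) → Prop
  | 0, Φ => Φ = 𝟙 _
  | n + 1, Φ => ∀ (d : Fin (n + 1) → ℕ) (a : ∀ j, (H.obj (op X) (d j) : Type x)),
      totalMap Φ (μ.iter (power X (n + 1)) n fun j =>
          homog (V := H.obj (op (power X (n + 1)))) (d j) (pullback H (proj X (n + 1) j) (d j) (a j))) =
        μ.iter (power X (n + 1)) n fun j =>
          homog (V := H.obj (op (power X (n + 1)))) (d j)
            (pullback H (proj X (n + 1) j) (d j) ((φ (d j)).hom (a j)))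

/-- The generating function `∑ n, L_u(Φ_n restricted to H^•(X ^ n)^(S_n)) t ^ n` in `k⟦u⟧⟦t⟧`, for
graded endomorphisms `Φ_n` of `H^•(X ^ n)` that preserve the invariants. -/
def generatingSeries (H : Cᵒᵖ ⥤ GrVec.{u, x} k) (X : C)
    (Φ : ∀ n : ℕ, H.obj (op (power X n)) ⟶ H.obj (op (power X n)))
    (hΦ : ∀ n i, ∀ y ∈ (permRep H X n i).invariants, (Φ n i).hom y ∈ (permRep H X n i).invariants) :
    PowerSeries (PowerSeries k) :=
  PowerSeries.mk fun n => lefschetz fun i => (Φ n i).hom.restrict (hΦ n i)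

end GradedCohomology

end

open GradedCohomology

/-! By the Künneth formula H^•(X^n) is the n-th tensor power of H^•(X) and the induced endomorphism
is φ^{⊗n}; by graded commutativity S_n permutes the tensor factors with Koszul signs. Put F = ⨁ φ_i
u^i over k⟦u⟧ and write str for the supertrace. In characteristic 0 averaging projects onto the
invariants, so the n-th Lefschetz series h_n satisfies n! h_n = Σ_σ str(σ ∘ F^{⊗n})
(`factorial_mul_lefschetz`).

These sums are evaluated without cycle types or eigenvalues, through Newton's identities (n+1)
h_{n+1} = Σ_{p+q=n} h_p str(F^{q+1}) (`succ_mul_eq_sum`). The cosets of S_n in S_{n+1} are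
represented by the transpositions of j with the last point. In the trace against F^{⊗n} ⊗ ψ the
trivial coset splits off a factor str(ψ). Every other coset, once its transposition is conjugated to
that of the last two factors, becomes a partial trace that merges F and ψ into ψF
(`trace_mul_superSwap`). Iterating from ψ = F gives the identities.

For G = Σ h_n t^n they say that G' = G Σ_m str(F^{m+1}) t^m. By Jacobi's formula det(1 - tF_i) has
logarithmic derivative -Σ_m tr(F_i^{m+1}) t^m. So G times the even determinants and the product of
the odd ones solve the same first-order linear differential equation with constant term 1, hence
agree in characteristic 0.

No unit is assumed for the cup product. The Künneth formula and the nonvanishing of H produce one on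
a terminal object (`Kunneth.exists_unit`); this makes H^•(X^0) one-dimensional and starts the
inductions on n. -/

section Series

/-! ### Logarithmic derivatives of determinants over power series. -/

open PowerSeries

theorem Derivation.map_prod_eq_sum {R A ι : Type*} [CommRing R] [CommRing A] [Algebra R A]
    [DecidableEq ι] (D : Derivation R A A) (s : Finset ι) (f : ι → A) :
    D (∏ i ∈ s, f i) = ∑ i ∈ s, D (f i) * ∏ j ∈ s.erase i, f j := by
  induction s using Finset.induction_on with
  | empty => simp
  | insert a s ha ih =>
    rw [Finset.prod_insert ha, D.leibniz, ih, Finset.sum_insert ha, Finset.erase_insert ha,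
      smul_eq_mul, smul_eq_mul, add_comm, mul_comm, Finset.mul_sum]
    congr 1
    refine Finset.sum_congr rfl fun i hi => ?_
    have hne : a ≠ i := by rintro rfl; exact ha hi
    rw [Finset.erase_insert_of_ne hne, Finset.prod_insert (by simp [ha])]
    ring

/-- Jacobi's formula for a derivation. -/
theorem Derivation.map_det {R A n : Type*} [CommRing R] [CommRing A] [Algebra R A]
    [DecidableEq n] [Fintype n] (D : Derivation R A A) (M : Matrix n n A) :
    D M.det = (M.adjugate * M.map D).trace := by
  -- By Cramer's rule the trace is a sum of determinants with one column differentiated; this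
  -- matches the Leibniz rule applied to each term of the determinant.
  have h1 : (M.adjugate * M.map D).trace = ∑ i, (M.updateCol i fun j => D (M j i)).det := by
    refine Finset.sum_congr rfl fun i _ => ?_
    rw [← Matrix.cramer_apply, Matrix.cramer_eq_adjugate_mulVec]
    rfl
  rw [h1, Matrix.det_apply, map_sum]
  simp_rw [Matrix.det_apply]
  rw [Finset.sum_comm]
  refine Finset.sum_congr rfl fun σ _ => ?_
  rw [Units.smul_def, map_zsmul, D.map_prod_eq_sum, Finset.smul_sum]
  refine Finset.sum_congr rfl fun i _ => ?_
  rw [Units.smul_def, ← Finset.mul_prod_erase _ _ (Finset.mem_univ i)]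
  congr 2
  · simp
  · refine Finset.prod_congr rfl fun j hj => ?_
    rw [Matrix.updateCol_ne (Finset.ne_of_mem_erase hj)]

/-- The logarithmic derivative of `det (1 - X F)`. -/
theorem PowerSeries.derivative_det_one_sub_X_smul {R n : Type*} [CommRing R] [DecidableEq n]
    [Fintype n] (F : Matrix n n R) :
    d⁄dX R (1 - (X : R⟦X⟧) • F.map C).det =
      -((1 - (X : R⟦X⟧) • F.map C).det * PowerSeries.mk fun m => (F ^ (m + 1)).trace) := by
  set M := 1 - (X : R⟦X⟧) • F.map C with hM
  -- `N` is the geometric series F(1 - XF)⁻¹. From `M * N = F` the trace in Jacobi's formula becomes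
  -- -tr(adj M · M · N) = -det M · tr N.
  let N : Matrix n n R⟦X⟧ := Matrix.of fun i j => PowerSeries.mk fun m => (F ^ (m + 1)) i j
  have hMN : M * N = F.map C := by
    have hFN : ∀ i j, (F.map C * N) i j = PowerSeries.mk fun m => (F ^ (m + 2)) i j := by
      intro i j
      ext m
      rw [Matrix.mul_apply, map_sum, coeff_mk, pow_succ' F (m + 1), Matrix.mul_apply]
      simp [N]
    ext i j m
    rw [hM, sub_mul, one_mul, smul_mul_assoc, Matrix.sub_apply, Matrix.smul_apply, hFN,
      smul_eq_mul, map_sub, Matrix.map_apply]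
    cases m with
    | zero => simp [N]
    | succ m => simp [N, coeff_succ_X_mul]
  have hD : M.map (d⁄dX R) = -(F.map C) := by
    ext i j : 2
    simp only [hM, Matrix.map_apply, Matrix.sub_apply, Matrix.smul_apply, map_sub, smul_eq_mul,
      Derivation.leibniz, derivative_C, derivative_X, Matrix.neg_apply]
    by_cases hij : i = j <;> simp [Matrix.one_apply, hij]
  have hN : N.trace = PowerSeries.mk fun m => (F ^ (m + 1)).trace := by
    ext m
    simp [N, Matrix.trace]
  rw [Derivation.map_det, hD, ← hMN, Matrix.mul_neg, ← mul_assoc, Matrix.adjugate_mul,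
    Matrix.trace_neg, smul_mul_assoc, one_mul, Matrix.trace_smul, hN, smul_eq_mul]

/-- The equation determines (n+1) times the coefficient of degree n+1 from the lower ones, and n+1
can be cancelled in a domain of characteristic 0. -/
theorem PowerSeries.eq_of_derivative_eq_mul {R : Type*} [CommRing R] [IsDomain R] [CharZero R]
    {f g h : R⟦X⟧} (hf : d⁄dX R f = f * h) (hg : d⁄dX R g = g * h)
    (h0 : constantCoeff f = constantCoeff g) : f = g := by
  ext n
  induction n using Nat.strong_induction_on with
  | _ n ih =>
    cases n with
    | zero => simpa using h0
    | succ n =>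
      have e1 := congrArg (coeff n) hf
      have e2 := congrArg (coeff n) hg
      rw [coeff_derivative, coeff_mul] at e1 e2
      have : (coeff (n + 1) f) * ((n : R) + 1) = coeff (n + 1) g * ((n : R) + 1) := by
        rw [e1, e2]
        refine Finset.sum_congr rfl fun p hp => ?_
        rw [ih p.1 (by have := Finset.HasAntidiagonal.mem_antidiagonal.1 hp; omega)]
      exact mul_right_cancel₀ (Nat.cast_add_one_ne_zero n) this

/-- Logarithmic derivatives add up over products; the form without division avoids inverting the
factors. -/
theorem Derivation.map_prod_of_eq_neg_mul {R A ι : Type*} [CommRing R] [CommRing A] [Algebra R A]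
    (D : Derivation R A A) (s : Finset ι) {f g : ι → A} (h : ∀ i ∈ s, D (f i) = -(f i * g i)) :
    D (∏ i ∈ s, f i) = -((∏ i ∈ s, f i) * ∑ i ∈ s, g i) := by
  classical
  induction s using Finset.induction_on with
  | empty => simp
  | insert a s ha ih =>
    rw [Finset.prod_insert ha, D.leibniz, ih fun i hi => h i (by simp [hi]), h a (by simp),
      Finset.sum_insert ha, smul_eq_mul, smul_eq_mul]
    ring

theorem PowerSeries.constantCoeff_det_one_sub_X_smul {R n : Type*} [CommRing R] [DecidableEq n]
    [Fintype n] (F : Matrix n n R) :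
    constantCoeff (1 - (X : R⟦X⟧) • F.map C).det = 1 := by
  have h1 : constantCoeff.mapMatrix (1 - (X : R⟦X⟧) • F.map C) = 1 := by
    ext a b
    by_cases hab : a = b <;> simp [Matrix.one_apply, hab]
  rw [RingHom.map_det, h1, Matrix.det_one]

/-- A power series whose logarithmic derivative is the alternating sum of the power sums of the
matrices `F i` is the alternating product of the series `det (1 - X (F i))`. -/
theorem PowerSeries.mul_prod_det_eq_prod_det {R : Type*} [CommRing R] [IsDomain R] [CharZero R]
    {n : ℕ → Type*} [∀ i, DecidableEq (n i)] [∀ i, Fintype (n i)]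
    (F : ∀ i, Matrix (n i) (n i) R) (d : ℕ) {G : R⟦X⟧} (hG0 : constantCoeff G = 1)
    (hG : d⁄dX R G = G * PowerSeries.mk fun m =>
      ∑ i ∈ Finset.range (2 * d + 1), (-1) ^ i * (F i ^ (m + 1)).trace) :
    G * ∏ j ∈ Finset.range (d + 1), (1 - (X : R⟦X⟧) • (F (2 * j)).map C).det =
      ∏ j ∈ Finset.range d, (1 - (X : R⟦X⟧) • (F (2 * j + 1)).map C).det := by
  have hc := fun i => constantCoeff_det_one_sub_X_smul (F i)
  let P : ℕ → R⟦X⟧ := fun i => PowerSeries.mk fun m => (F i ^ (m + 1)).trace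
  have hs : (PowerSeries.mk fun m =>
      ∑ i ∈ Finset.range (2 * d + 1), (-1) ^ i * (F i ^ (m + 1)).trace) =
      ∑ j ∈ Finset.range (d + 1), P (2 * j) - ∑ j ∈ Finset.range d, P (2 * j + 1) := by
    ext m
    rw [coeff_mk, map_sub, map_sum, map_sum]
    simp only [P, coeff_mk]
    clear hG
    induction d with
    | zero => simp
    | succ d ih =>
      rw [show 2 * (d + 1) + 1 = 2 * d + 1 + 1 + 1 by ring, Finset.sum_range_succ,
        Finset.sum_range_succ, ih, Finset.sum_range_succ _ (d + 1),
        Finset.sum_range_succ (fun j => ((F (2 * j + 1)) ^ (m + 1)).trace) d,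
        show 2 * d + 1 + 1 = 2 * (d + 1) by ring]
      simp [pow_add, pow_mul]
      ring
  have hE := (d⁄dX R).map_prod_of_eq_neg_mul (Finset.range (d + 1))
    (f := fun j => (1 - (X : R⟦X⟧) • (F (2 * j)).map C).det) (g := fun j => P (2 * j))
    fun j _ => derivative_det_one_sub_X_smul _
  have hO := (d⁄dX R).map_prod_of_eq_neg_mul (Finset.range d)
    (f := fun j => (1 - (X : R⟦X⟧) • (F (2 * j + 1)).map C).det) (g := fun j => P (2 * j + 1))
    fun j _ => derivative_det_one_sub_X_smul _
  -- The even power sums in the logarithmic derivative of `G` cancel against those of the even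
  -- determinants; only the odd ones, with a minus sign, remain.
  refine eq_of_derivative_eq_mul (h := -∑ j ∈ Finset.range d, P (2 * j + 1)) ?_ ?_ ?_
  · rw [Derivation.leibniz, hE, hG, hs, smul_eq_mul, smul_eq_mul]
    ring
  · rw [hO]
    ring
  · simp only [map_mul, map_prod, hc, hG0]
    simp

end Series

/-! ### Cosets of S_n in S_(n+1). -/

section Permutations

open Equiv

/-- The embedding of `S_n` into `S_(n+1)` as the stabilizer of the last point. -/
noncomputable def extendLast (n : ℕ) : Perm (Fin n) →* Perm (Fin (n + 1)) :=
  Perm.viaEmbeddingHom (Fin.castSuccEmb : Fin n ↪ Fin (n + 1))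

@[simp] theorem extendLast_castSucc {n : ℕ} (τ : Perm (Fin n)) (j : Fin n) :
    extendLast n τ j.castSucc = (τ j).castSucc :=
  Perm.viaEmbedding_apply τ (Fin.castSuccEmb : Fin n ↪ Fin (n + 1)) j

@[simp] theorem extendLast_last {n : ℕ} (τ : Perm (Fin n)) :
    extendLast n τ (Fin.last n) = Fin.last n :=
  Perm.viaEmbedding_apply_of_notMem τ (Fin.castSuccEmb : Fin n ↪ Fin (n + 1)) _ (by simp)

theorem extendLast_injective (n : ℕ) : Function.Injective (extendLast n) :=
  Perm.viaEmbeddingHom_injective _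

/-- The transposition of the last two points. -/
def swapLastTwo (n : ℕ) : Perm (Fin (n + 2)) := swap (Fin.last n).castSucc (Fin.last (n + 1))

/-- Conjugation by a transposition that fixes the last point. It reduces every coset representative
to `swapLastTwo`, the only transposition whose matrix is prescribed in `IsKoszulAction`. -/
theorem swap_castSucc_last (n : ℕ) (i : Fin (n + 1)) :
    swap i.castSucc (Fin.last (n + 1)) = extendLast (n + 1) (swap i (Fin.last n)) *
      swapLastTwo n * extendLast (n + 1) (swap i (Fin.last n)) := by
  have h := swap_apply_apply (extendLast (n + 1) (swap i (Fin.last n))) (Fin.last n).castSucc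
    (Fin.last (n + 1))
  rw [← map_inv, swap_inv] at h
  rw [swapLastTwo, ← h]
  simp

/-- The index j is recovered as the point sent to the last one, and then τ by cancellation; the
cardinalities agree because (n+1)! = (n+1) n!. -/
theorem bijective_extendLast_mul_swap (n : ℕ) : Function.Bijective
    fun p : Fin (n + 1) × Perm (Fin n) => extendLast n p.2 * swap p.1 (Fin.last n) := by
  rw [Fintype.bijective_iff_injective_and_card]
  refine ⟨?_, by simp [Fintype.card_perm, Nat.factorial_succ]⟩
  rintro ⟨j, τ⟩ ⟨j', τ'⟩ h
  have e1 : (extendLast n τ' * swap j' (Fin.last n)) j = Fin.last n := by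
    have := congrArg (fun σ : Perm (Fin (n + 1)) => σ j) h
    simpa using this.symm
  have e2 : (extendLast n τ' * swap j' (Fin.last n)) j' = Fin.last n := by simp
  obtain rfl : j = j' := (extendLast n τ' * swap j' (Fin.last n)).injective (e1.trans e2.symm)
  simpa using (extendLast_injective n) (mul_right_cancel h)

theorem sum_perm_succ {M : Type*} [AddCommMonoid M] (n : ℕ) (f : Perm (Fin (n + 1)) → M) :
    ∑ σ, f σ = ∑ j, ∑ τ, f (extendLast n τ * swap j (Fin.last n)) := by
  rw [← Fintype.sum_prod_type' fun j τ => f (extendLast n τ * swap j (Fin.last n))]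
  exact ((bijective_extendLast_mul_swap n).sum_comp f).symm

theorem exists_eq_extendLast_mul_swap {n : ℕ} (σ : Perm (Fin (n + 1))) :
    ∃ j τ, σ = extendLast n τ * swap j (Fin.last n) := by
  obtain ⟨⟨j, τ⟩, h⟩ := (bijective_extendLast_mul_swap n).2 σ
  exact ⟨j, τ, h.symm⟩

end Permutations

/-! ### Koszul sign actions on tensor powers and Newton's identities. -/

section Koszul

open Equiv Matrix
open scoped Kronecker

/-- The index type of a basis of the `n`-th tensor power of a module with a basis indexed
by `ι`. -/
def PowerIndex (ι : Type x) : ℕ → Type x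
  | 0 => PUnit
  | n + 1 => PowerIndex ι n × ι

noncomputable instance PowerIndex.fintype (ι : Type x) [Fintype ι] : ∀ n, Fintype (PowerIndex ι n)
  | 0 => inferInstanceAs (Fintype PUnit)
  | n + 1 => by
    haveI := PowerIndex.fintype ι n
    exact inferInstanceAs (Fintype (PowerIndex ι n × ι))

instance PowerIndex.decidableEq (ι : Type x) [DecidableEq ι] : ∀ n, DecidableEq (PowerIndex ι n)
  | 0 => inferInstanceAs (DecidableEq PUnit)
  | n + 1 => by
    haveI := PowerIndex.decidableEq ι n
    exact inferInstanceAs (DecidableEq (PowerIndex ι n × ι))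

variable {R : Type*} [CommRing R] {ι : Type x}

/-- The Kronecker product, as a matrix indexed by `PowerIndex ι (n + 1)`. -/
def kron {n : ℕ} (A : Matrix (PowerIndex ι n) (PowerIndex ι n) R) (B : Matrix ι ι R) :
    Matrix (PowerIndex ι (n + 1)) (PowerIndex ι (n + 1)) R := A ⊗ₖ B

/-- The `n`-th Kronecker power of a matrix. -/
def kroneckerPow [DecidableEq ι] (M : Matrix ι ι R) : ∀ n, Matrix (PowerIndex ι n) (PowerIndex ι n) R
  | 0 => 1
  | n + 1 => kron (kroneckerPow M n) M

theorem kroneckerPow_succ [DecidableEq ι] (M : Matrix ι ι R) (n : ℕ) :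
    kroneckerPow M (n + 1) = kron (kroneckerPow M n) M := rfl

theorem kron_mul_kron [Fintype ι] {n : ℕ} (A A' : Matrix (PowerIndex ι n) (PowerIndex ι n) R)
    (B B' : Matrix ι ι R) : kron A B * kron A' B' = kron (A * A') (B * B') :=
  (Matrix.mul_kronecker_mul A A' B B').symm

theorem trace_kron [Fintype ι] {n : ℕ} (A : Matrix (PowerIndex ι n) (PowerIndex ι n) R) (B : Matrix ι ι R) :
    (kron A B).trace = A.trace * B.trace := Matrix.trace_kronecker A B

theorem sum_kron {n : ℕ} {α : Type*} (s : Finset α)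
    (A : α → Matrix (PowerIndex ι n) (PowerIndex ι n) R) (B : Matrix ι ι R) :
    ∑ i ∈ s, kron (A i) B = kron (∑ i ∈ s, A i) B := by
  ext p q
  rw [Matrix.sum_apply]
  change ∑ i ∈ s, A i p.1 q.1 * B p.2 q.2 = (∑ i ∈ s, A i) p.1 q.1 * B p.2 q.2
  rw [Matrix.sum_apply, Finset.sum_mul]

variable [Fintype ι] [DecidableEq ι]

/-- The matrix of `x ⊗ a ⊗ b ↦ (-1) ^ (deg a * deg b) • x ⊗ b ⊗ a`. -/
def superSwap (R : Type*) [CommRing R] (κ : Type*) [DecidableEq κ] (deg : ι → ℕ) :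
    Matrix ((κ × ι) × ι) ((κ × ι) × ι) R :=
  Matrix.of fun p q =>
    if p = ((q.1.1, q.2), q.1.2) then (-1) ^ (deg q.1.2 * deg q.2) else 0

section SuperSwap

variable {κ : Type*} [Fintype κ] [DecidableEq κ] (deg : ι → ℕ)

theorem mul_superSwap_apply {α : Type*} (N : Matrix α ((κ × ι) × ι) R) (p : α) (y : κ) (c d : ι) :
    (N * superSwap R κ deg) p ((y, c), d) = N p ((y, d), c) * (-1) ^ (deg c * deg d) := by
  simp [Matrix.mul_apply, superSwap]

theorem superSwap_mul_apply {α : Type*} (N : Matrix ((κ × ι) × ι) α R) (q : α) (x : κ) (a b : ι) :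
    (superSwap R κ deg * N) ((x, a), b) q = (-1) ^ (deg a * deg b) * N ((x, b), a) q := by
  rw [Matrix.mul_apply, Finset.sum_eq_single ((x, b), a)]
  · simp [superSwap, mul_comm]
  · rintro ⟨⟨y, c⟩, d⟩ - h
    have : ¬ ((x, a), b) = (((y, d), c) : (κ × ι) × ι) := by
      rintro ⟨⟩
      exact h rfl
    simp [superSwap, this]
  · simp

/-- A degree-preserving matrix has nonzero entries only between indices of equal degree, so the two
Koszul signs agree wherever they matter. -/
theorem superSwap_mul_kronecker {M : Matrix ι ι R} (hM : ∀ a b, deg a ≠ deg b → M a b = 0)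
    (B : Matrix κ κ R) :
    superSwap R κ deg * ((B ⊗ₖ M) ⊗ₖ M) = ((B ⊗ₖ M) ⊗ₖ M) * superSwap R κ deg := by
  ext ⟨⟨x, a⟩, b⟩ ⟨⟨y, c⟩, d⟩
  rw [mul_superSwap_apply, superSwap_mul_apply]
  simp only [Matrix.kronecker_apply]
  by_cases h1 : deg b = deg c
  · by_cases h2 : deg a = deg d
    · rw [h1, h2, mul_comm (deg d)]
      ring
    · rw [hM a d h2]
      ring
  · rw [hM b c h1]
    ring

/-- The trace of an operator composed with the graded transposition is a partial trace. -/
theorem trace_mul_superSwap {D : Matrix κ κ R} (S : Matrix (κ × ι) (κ × ι) R) (B : Matrix κ κ R)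
    {F ψ : Matrix ι ι R} (hψ : ∀ a b, deg a ≠ deg b → ψ a b = 0) :
    (((D ⊗ₖ diagonal fun a => (-1) ^ deg a) ⊗ₖ diagonal fun a => (-1) ^ deg a) *
        (S ⊗ₖ (1 : Matrix ι ι R)) * superSwap R κ deg * ((B ⊗ₖ F) ⊗ₖ ψ)).trace =
      ((D ⊗ₖ diagonal fun a => (-1) ^ deg a) * S * (B ⊗ₖ (ψ * F))).trace := by
  set E : Matrix ι ι R := diagonal fun a => (-1) ^ deg a
  rw [← Matrix.mul_kronecker_mul, mul_one]
  set T := (D ⊗ₖ E) * S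
  have h1 : ∀ p : (κ × ι) × ι, ((T ⊗ₖ E) * superSwap R κ deg * ((B ⊗ₖ F) ⊗ₖ ψ)) p p =
      ∑ y, ∑ c, T p.1 (y, c) * B y p.1.1 * (F p.2 p.1.2 * ψ c p.2) := by
    rintro ⟨⟨x, a⟩, b⟩
    rw [Matrix.mul_apply]
    simp only [Fintype.sum_prod_type, mul_superSwap_apply, Matrix.kronecker_apply]
    refine Finset.sum_congr rfl fun y _ => ?_
    rw [Finset.sum_comm]
    refine Finset.sum_congr rfl fun c _ => ?_
    -- The diagonal matrix `E` leaves only the index `b`.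
    rw [Finset.sum_eq_single b]
    · by_cases h : deg c = deg b
      · rw [h]
        -- The sign of the supertrace on the last factor cancels the Koszul sign, since deg b (deg b
        -- + 1) is even.
        have e : E b b * (-1) ^ (deg b * deg b) = 1 := by
          simp only [E, diagonal_apply_eq, ← pow_add]
          exact Even.neg_one_pow (by
            rw [show deg b + deg b * deg b = deg b * (deg b + 1) by ring]
            exact Nat.even_mul_succ_self _)
        calc _ = (E b b * (-1) ^ (deg b * deg b)) * (T (x, a) (y, c) * B y x * (F b a * ψ c b)) := by
              ring
          _ = _ := by rw [e, one_mul]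
      · rw [hψ c b h]
        ring
    · intro d _ hd
      simp [E, diagonal_apply_ne _ hd.symm]
    · simp
  have h2 : ∀ q : κ × ι, (T * (B ⊗ₖ (ψ * F))) q q =
      ∑ b, ∑ y, ∑ c, T q (y, c) * B y q.1 * (F b q.2 * ψ c b) := by
    rintro ⟨x, a⟩
    rw [Matrix.mul_apply]
    simp only [Fintype.sum_prod_type, Matrix.kronecker_apply, Matrix.mul_apply, Finset.mul_sum]
    rw [Finset.sum_congr rfl fun y _ => Finset.sum_comm, Finset.sum_comm]
    refine Finset.sum_congr rfl fun b _ => Finset.sum_congr rfl fun y _ =>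
      Finset.sum_congr rfl fun c _ => ?_
    ring
  simp only [Matrix.trace, Matrix.diag_apply, h1, h2]
  rw [Fintype.sum_prod_type]

end SuperSwap

/-- The graded transposition of the last two factors, as a matrix indexed by
`PowerIndex ι (n + 2)`. -/
def powSuperSwap (R : Type*) [CommRing R] (deg : ι → ℕ) (n : ℕ) :
    Matrix (PowerIndex ι (n + 2)) (PowerIndex ι (n + 2)) R :=
  superSwap R (PowerIndex ι n) deg

theorem powSuperSwap_mul_kron {deg : ι → ℕ} {n : ℕ} {M : Matrix ι ι R}
    (hM : ∀ a b, deg a ≠ deg b → M a b = 0) (B : Matrix (PowerIndex ι n) (PowerIndex ι n) R) :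
    powSuperSwap R deg n * kron (kron B M) M = kron (kron B M) M * powSuperSwap R deg n :=
  superSwap_mul_kronecker deg hM B

theorem trace_mul_powSuperSwap {deg : ι → ℕ} {n : ℕ}
    (D : Matrix (PowerIndex ι n) (PowerIndex ι n) R)
    (S : Matrix (PowerIndex ι (n + 1)) (PowerIndex ι (n + 1)) R)
    (B : Matrix (PowerIndex ι n) (PowerIndex ι n) R)
    {F ψ : Matrix ι ι R} (hψ : ∀ a b, deg a ≠ deg b → ψ a b = 0) :
    (kron (kron D (diagonal fun a => (-1) ^ deg a)) (diagonal fun a => (-1) ^ deg a) *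
        kron S 1 * powSuperSwap R deg n * kron (kron B F) ψ).trace =
      (kron D (diagonal fun a => (-1) ^ deg a) * S * kron B (ψ * F)).trace :=
  trace_mul_superSwap deg S B hψ

/-- Matrices of the action of the symmetric groups on the tensor powers of a graded module, the
action being given by the Koszul sign rule. -/
structure IsKoszulAction (deg : ι → ℕ)
    (ρ : ∀ n, Perm (Fin n) →* Matrix (PowerIndex ι n) (PowerIndex ι n) R) : Prop where
  extendLast (n : ℕ) (τ : Perm (Fin n)) :
    ρ (n + 1) (extendLast n τ) = kron (ρ n τ) 1
  swapLastTwo (n : ℕ) : ρ (n + 2) (swapLastTwo n) = powSuperSwap R deg n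


namespace IsKoszulAction

variable {deg : ι → ℕ} {ρ : ∀ n, Perm (Fin n) →* Matrix (PowerIndex ι n) (PowerIndex ι n) R}

/-- S_(n+2) is generated by S_(n+1), handled by induction, and the transposition of the last two
points, handled by `superSwap_mul_kronecker`. -/
theorem commute_kroneckerPow (hρ : IsKoszulAction deg ρ) {M : Matrix ι ι R}
    (hM : ∀ a b, deg a ≠ deg b → M a b = 0) (n : ℕ) (σ : Perm (Fin n)) :
    Commute (ρ n σ) (kroneckerPow M n) := by
  induction n with
  | zero => exact Commute.one_right _
  | succ n ih =>
    have hext : ∀ τ, Commute (ρ (n + 1) (_root_.extendLast n τ)) (kroneckerPow M (n + 1)) := by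
      intro τ
      rw [hρ.extendLast]
      rw [kroneckerPow_succ, commute_iff_eq, kron_mul_kron, kron_mul_kron, (ih τ).eq, one_mul, mul_one]
    cases n with
    | zero =>
      obtain rfl : σ = 1 := Equiv.ext fun x => Subsingleton.elim (α := Fin 1) _ _
      rw [map_one]
      exact Commute.one_left _
    | succ n =>
      obtain ⟨j, τ, rfl⟩ := exists_eq_extendLast_mul_swap σ
      rw [map_mul]
      refine (hext τ).mul_left ?_
      induction j using Fin.lastCases with
      | last =>
        rw [swap_self]
        change Commute (ρ (n + 2) 1) _
        rw [map_one]
        exact Commute.one_left _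
      | cast i =>
        rw [swap_castSucc_last, map_mul, map_mul]
        refine ((hext _).mul_left ?_).mul_left (hext _)
        rw [hρ.swapLastTwo]
        exact powSuperSwap_mul_kron hM _

/-- The sum of all permutations. -/
noncomputable def symm (ρ : ∀ n, Perm (Fin n) →* Matrix (PowerIndex ι n) (PowerIndex ι n) R) (n : ℕ) :
    Matrix (PowerIndex ι n) (PowerIndex ι n) R := ∑ σ, ρ n σ

theorem symm_mul (n : ℕ) (σ : Perm (Fin n)) : symm ρ n * ρ n σ = symm ρ n := by
  rw [symm, Finset.sum_mul]
  simp_rw [← map_mul]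
  exact (Group.mulRight_bijective σ).sum_comp fun τ => ρ n τ

theorem mul_symm (n : ℕ) (σ : Perm (Fin n)) : ρ n σ * symm ρ n = symm ρ n := by
  rw [symm, Finset.mul_sum]
  simp_rw [← map_mul]
  exact (Group.mulLeft_bijective σ).sum_comp fun τ => ρ n τ

theorem symm_succ (hρ : IsKoszulAction deg ρ) (n : ℕ) :
    symm ρ (n + 1) = ∑ j, kron (symm ρ n) 1 * ρ (n + 1) (swap j (Fin.last n)) := by
  rw [symm, sum_perm_succ]
  refine Finset.sum_congr rfl fun j _ => ?_
  simp_rw [map_mul, hρ.extendLast]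
  rw [← Finset.sum_mul, symm]
  rw [sum_kron]

/-- The supertrace of `(∑ σ, σ) ∘ (F ⊗ ⋯ ⊗ F ⊗ ψ)`. -/
noncomputable def symTrace (deg : ι → ℕ) (ρ : ∀ n, Perm (Fin n) →* Matrix (PowerIndex ι n) (PowerIndex ι n) R)
    (F ψ : Matrix ι ι R) (n : ℕ) : R :=
  (kroneckerPow (diagonal fun a => (-1) ^ deg a) (n + 1) * symm ρ (n + 1) *
    kron (kroneckerPow F n) ψ).trace

/-- The supertrace of `(∑ σ, σ) ∘ (F ⊗ ⋯ ⊗ F)`. -/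
noncomputable def symTracePow (deg : ι → ℕ)
    (ρ : ∀ n, Perm (Fin n) →* Matrix (PowerIndex ι n) (PowerIndex ι n) R)
    (F : Matrix ι ι R) (n : ℕ) : R :=
  (kroneckerPow (diagonal fun a => (-1) ^ deg a) n * symm ρ n * kroneckerPow F n).trace

theorem symTrace_self (F : Matrix ι ι R) (n : ℕ) :
    symTrace deg ρ F F n = symTracePow deg ρ F (n + 1) := rfl

theorem symTracePow_zero (F : Matrix ι ι R) : symTracePow deg ρ F 0 = 1 := by
  have : symm ρ 0 = 1 := by
    rw [symm, Fintype.sum_unique, Subsingleton.elim default 1, map_one]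
  rw [symTracePow, this]
  change Matrix.trace ((1 : Matrix (PowerIndex ι 0) (PowerIndex ι 0) R) * 1 * 1) = 1
  rw [mul_one, mul_one, Matrix.trace_one]
  exact (congrArg Nat.cast (Fintype.card_punit)).trans Nat.cast_one

/-- The supertrace of `ψ`. -/
noncomputable def superTrace (deg : ι → ℕ) (ψ : Matrix ι ι R) : R := (diagonal (fun a => (-1) ^ deg a) * ψ).trace

/-- Contribution of the trivial coset: the operator is a Kronecker product, so its trace factors. -/
theorem trace_last (F ψ : Matrix ι ι R) (n : ℕ) :
    (kroneckerPow (diagonal fun a => (-1) ^ deg a) (n + 1) * kron (symm ρ n) 1 *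
      kron (kroneckerPow F n) ψ).trace = superTrace deg ψ * symTracePow deg ρ F n := by
  rw [kroneckerPow_succ, kron_mul_kron, kron_mul_kron, trace_kron, mul_one,
    mul_comm]
  rfl

/-- Contribution of a nontrivial coset. Its transposition is τsτ with s the swap of the last two
factors and τ in S_(n+1). One τ is absorbed by the symmetrizer directly, the other after being moved
around the trace; what is left is the partial trace of s. -/
theorem trace_cast (hρ : IsKoszulAction deg ρ) {F ψ : Matrix ι ι R}
    (hF : ∀ a b, deg a ≠ deg b → F a b = 0) (hψ : ∀ a b, deg a ≠ deg b → ψ a b = 0) (n : ℕ)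
    (i : Fin (n + 1)) :
    (kroneckerPow (diagonal fun a => (-1) ^ deg a) (n + 2) *
      (kron (symm ρ (n + 1)) 1 * ρ (n + 2) (swap i.castSucc (Fin.last (n + 1)))) *
      kron (kroneckerPow F (n + 1)) ψ).trace = symTrace deg ρ F (ψ * F) n := by
  set E : Matrix ι ι R := diagonal fun a => (-1) ^ deg a with hE
  set τ := swap i (Fin.last n)
  have c1 : kron (ρ (n + 1) τ) 1 * kron (kroneckerPow F (n + 1)) ψ =
      kron (kroneckerPow F (n + 1)) ψ * kron (ρ (n + 1) τ) 1 := by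
    rw [kron_mul_kron, kron_mul_kron,
      (hρ.commute_kroneckerPow hF (n + 1) τ).eq, one_mul, mul_one]
  have c2 : kron (ρ (n + 1) τ) 1 * (kroneckerPow E (n + 2)) =
      kroneckerPow E (n + 2) * kron (ρ (n + 1) τ) 1 := by
    rw [← hρ.extendLast]
    exact (hρ.commute_kroneckerPow (fun a b hab => diagonal_apply_ne _
      (fun h => hab (congrArg deg h))) (n + 2) _).eq
  have c3 : kron (symm ρ (n + 1)) 1 * kron (ρ (n + 1) τ) 1 =
      kron (symm ρ (n + 1)) 1 := by
    rw [kron_mul_kron, symm_mul, one_mul]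
  have c4 : kron (ρ (n + 1) τ) 1 * kron (symm ρ (n + 1)) 1 =
      kron (symm ρ (n + 1)) 1 := by
    rw [kron_mul_kron, mul_symm, one_mul]
  rw [swap_castSucc_last, map_mul, map_mul, hρ.extendLast, hρ.swapLastTwo]
  have hT := trace_mul_powSuperSwap (kroneckerPow E n) (symm ρ (n + 1)) (kroneckerPow F n)
    (F := F) hψ
  rw [← kroneckerPow_succ, ← kroneckerPow_succ, ← kroneckerPow_succ] at hT
  rw [symTrace, ← hE, ← hT]
  generalize powSuperSwap R deg n = s at *
  generalize kron (ρ (n + 1) τ) 1 = t at *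
  generalize kron (symm ρ (n + 1)) 1 = S at *
  generalize kron (kroneckerPow F (n + 1)) ψ = Q at *
  generalize kroneckerPow E (n + 2) = D at *
  calc (D * (S * (t * s * t)) * Q).trace = (D * (S * t) * s * (t * Q)).trace := by
        simp only [Matrix.mul_assoc]
    _ = ((D * S * s * Q) * t).trace := by rw [c3, c1]; simp only [Matrix.mul_assoc]
    _ = ((t * D) * S * s * Q).trace := by rw [Matrix.trace_mul_comm]; simp only [Matrix.mul_assoc]
    _ = (D * (t * S) * s * Q).trace := by rw [c2]; simp only [Matrix.mul_assoc]
    _ = _ := by rw [c4]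

/-- Of the n+2 cosets the trivial one gives the first term; the other n+1 contribute equally. -/
theorem symTrace_succ (hρ : IsKoszulAction deg ρ) {F ψ : Matrix ι ι R}
    (hF : ∀ a b, deg a ≠ deg b → F a b = 0) (hψ : ∀ a b, deg a ≠ deg b → ψ a b = 0) (n : ℕ) :
    symTrace deg ρ F ψ (n + 1) = superTrace deg ψ * symTracePow deg ρ F (n + 1) +
      (n + 1) * symTrace deg ρ F (ψ * F) n := by
  conv_lhs => rw [symTrace, hρ.symm_succ, Finset.mul_sum, Finset.sum_mul, Matrix.trace_sum,
    Fin.sum_univ_castSucc]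
  rw [Finset.sum_congr rfl fun i _ => trace_cast hρ hF hψ n i, swap_self]
  change _ + (_ * (_ * ρ (n + 2) 1) * _).trace = _
  rw [map_one, mul_one, trace_last]
  simp [add_comm]

theorem symTrace_zero (hρ : IsKoszulAction deg ρ) (F ψ : Matrix ι ι R) :
    symTrace deg ρ F ψ 0 = superTrace deg ψ := by
  have h1 : swap (0 : Fin (0 + 1)) (Fin.last 0) = 1 := swap_self _
  rw [symTrace, hρ.symm_succ, Fin.sum_univ_one, h1, map_one, mul_one, trace_last, symTracePow_zero, mul_one]

/-- The recursion `symTrace_succ`, unrolled. The exponent must stay general, since each step raises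
it by one while collecting the factors of a falling factorial. -/
theorem symTrace_pow (hρ : IsKoszulAction deg ρ) {F : Matrix ι ι R}
    (hF : ∀ a b, deg a ≠ deg b → F a b = 0) (n a : ℕ) :
    symTrace deg ρ F (F ^ (a + 1)) n = ∑ p ∈ Finset.HasAntidiagonal.antidiagonal n,
      (n.descFactorial p.1 : R) * (superTrace deg (F ^ (a + p.1 + 1)) * symTracePow deg ρ F p.2) := by
  have hFa : ∀ a x y, deg x ≠ deg y → (F ^ (a + 1)) x y = 0 := by
    intro a
    induction a with
    | zero => simpa using hF
    | succ a ih =>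
      intro x y hxy
      rw [pow_succ, Matrix.mul_apply]
      refine Finset.sum_eq_zero fun z _ => ?_
      by_cases h : deg x = deg z
      · rw [hF z y (h ▸ hxy), mul_zero]
      · rw [ih x z h, zero_mul]
  induction n generalizing a with
  | zero => simp [hρ.symTrace_zero, symTracePow_zero]
  | succ n ih =>
    rw [hρ.symTrace_succ hF (hFa a), ← pow_succ, ih, Finset.Nat.antidiagonal_succ,
      Finset.sum_cons, Finset.sum_map, Finset.mul_sum]
    congr 1
    · simp
    · refine Finset.sum_congr rfl fun p _ => ?_
      simp only [Function.Embedding.prodMap, Function.Embedding.coeFn_mk, Prod.map,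
        Nat.succ_descFactorial_succ, Function.Embedding.refl_apply]
      rw [show a + 1 + p.1 + 1 = a + p.1.succ + 1 by simp; ring]
      push_cast
      ring

/-- Newton's identities for the supertraces of the symmetric powers. -/
theorem succ_mul_eq_sum (hρ : IsKoszulAction deg ρ) {F : Matrix ι ι R}
    (hF : ∀ a b, deg a ≠ deg b → F a b = 0) [IsDomain R] [CharZero R] {h : ℕ → R}
    (hh : ∀ n, (n.factorial : R) * h n = symTracePow deg ρ F n) (n : ℕ) :
    h (n + 1) * (n + 1) =
      ∑ p ∈ Finset.HasAntidiagonal.antidiagonal n, h p.1 * superTrace deg (F ^ (p.2 + 1)) := by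
  have hn : (n.factorial : R) ≠ 0 := Nat.cast_ne_zero.2 n.factorial_ne_zero
  apply mul_left_cancel₀ hn
  -- With exponent 1 the left side is (n+1)! h_(n+1). On the right, the falling factorial times
  -- `p.2!` is n!, which cancels.
  have h1 := hρ.symTrace_pow hF n 0
  rw [zero_add, pow_one, symTrace_self, ← hh, Nat.factorial_succ] at h1
  push_cast at h1
  rw [← Finset.Nat.sum_antidiagonal_swap]
  calc _ = ((n : R) + 1) * n.factorial * h (n + 1) := by ring
    _ = _ := h1
    _ = _ := by
      rw [Finset.mul_sum]
      refine Finset.sum_congr rfl fun p hp => ?_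
      have hp' : p.1 + p.2 = n := Finset.HasAntidiagonal.mem_antidiagonal.1 hp
      rw [← hh, zero_add, ← Nat.factorial_mul_descFactorial (k := p.1) (n := n) (by omega),
        show n - p.1 = p.2 by omega]
      simp only [Prod.fst_swap, Prod.snd_swap]
      push_cast
      ring

end IsKoszulAction

end Koszul

/-! ### Graded maps on total spaces, traces in homogeneous bases, and averaging. -/

namespace GradedCohomology

section TotalSpace

variable {k : Type u} [Field k] {V W U : GrVec.{u, x} k}

/-- The projection of the total space onto its part of degree `i`. -/
noncomputable def degreeProj (V : GrVec.{u, x} k) (i : ℕ) : TotalSpace V →ₗ[k] TotalSpace V :=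
  homog i ∘ₗ DirectSum.component k ℕ (fun i => (V i : Type x)) i

theorem degreeProj_homog_self (i : ℕ) (a : V i) :
    degreeProj V i (homog i a) = homog (V := V) i a := by
  simp [degreeProj, DirectSum.component.lof_self]

theorem degreeProj_homog_of_ne {i j : ℕ} (h : i ≠ j) (a : V j) :
    degreeProj V i (homog j a) = 0 := by
  rw [degreeProj, LinearMap.comp_apply, DirectSum.component.of, dif_neg h.symm, map_zero]

theorem degreeProj_homog (i j : ℕ) (a : V j) :
    degreeProj V i (homog j a) = if j = i then homog (V := V) j a else 0 := by
  split_ifs with h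
  · subst h
    exact degreeProj_homog_self j a
  · exact degreeProj_homog_of_ne (Ne.symm h) a

@[simp] theorem totalMap_homog (f : V ⟶ W) (i : ℕ) (a : V i) :
    totalMap f (homog i a) = homog (V := W) i ((f i).hom a) :=
  DirectSum.lmap_lof _ _ _

theorem totalMap_comp (f : V ⟶ W) (g : W ⟶ U) :
    totalMap (f ≫ g) = totalMap g ∘ₗ totalMap f := by
  refine DirectSum.linearMap_ext _ fun i => LinearMap.ext fun a => ?_
  simp only [LinearMap.comp_apply, totalMap_homog]
  rfl

theorem totalMap_id : totalMap (𝟙 V) = LinearMap.id := by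
  refine DirectSum.linearMap_ext _ fun i => LinearMap.ext fun a => ?_
  simp only [LinearMap.comp_apply, totalMap_homog]
  rfl

theorem homog_injective (i : ℕ) : Function.Injective (homog (V := V) i) :=
  DirectSum.of_injective (β := fun i => (V i : Type x)) i

theorem totalMap_injective {f g : V ⟶ W} (h : totalMap f = totalMap g) : f = g := by
  funext i
  ext a
  apply homog_injective (V := W) i
  rw [← totalMap_homog, ← totalMap_homog, h]

theorem degreeProj_comp_totalMap (f : V ⟶ W) (i : ℕ) :
    degreeProj W i ∘ₗ totalMap f = totalMap f ∘ₗ degreeProj V i := by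
  refine DirectSum.linearMap_ext _ fun j => LinearMap.ext fun a => ?_
  simp only [LinearMap.comp_apply, totalMap_homog]
  by_cases h : i = j
  · subst h
    rw [degreeProj_homog_self, degreeProj_homog_self, totalMap_homog]
  · rw [degreeProj_homog_of_ne h, degreeProj_homog_of_ne h, map_zero]

/-- This is how maps built through tensor products, hence only on total spaces, are recognized as
graded. -/
theorem exists_totalMap_eq (F : TotalSpace V →ₗ[k] TotalSpace W)
    (hF : ∀ i, degreeProj W i ∘ₗ F = F ∘ₗ degreeProj V i) : ∃ f : V ⟶ W, totalMap f = F := by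
  refine ⟨fun i => ModuleCat.ofHom
    (DirectSum.component k ℕ (fun i => (W i : Type x)) i ∘ₗ F ∘ₗ homog i), ?_⟩
  refine DirectSum.linearMap_ext _ fun i => LinearMap.ext fun a => ?_
  have := LinearMap.congr_fun (hF i) (homog i a)
  rw [LinearMap.comp_apply, LinearMap.comp_apply, degreeProj_homog_self] at this
  simp only [LinearMap.comp_apply, totalMap_homog]
  exact this

/-- A family of vectors is homogeneous of degrees `deg`. -/
def IsHomogeneousFamily {κ : Type*} (b : κ → TotalSpace V) (deg : κ → ℕ) : Prop :=
  ∀ x i, degreeProj V i (b x) = if deg x = i then b x else 0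

theorem repr_totalMap_eq_zero {κ : Type*} {b : Module.Basis κ k (TotalSpace V)}
    {deg : κ → ℕ} (hb : IsHomogeneousFamily b deg) (f : V ⟶ V) {x y : κ} (hxy : deg x ≠ deg y) :
    b.repr (totalMap f (b y)) x = 0 := by
  classical
  have key : ∀ w : TotalSpace V, b.repr (degreeProj V (deg x) w) x = b.repr w x := by
    intro w
    have : b.coord x ∘ₗ degreeProj V (deg x) = b.coord x := by
      refine b.ext fun z => ?_
      rw [LinearMap.comp_apply, hb]
      split_ifs with h
      · rfl
      · have : z ≠ x := by rintro rfl; exact h rfl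
        simp [this]
    exact LinearMap.congr_fun this w
  have h1 := LinearMap.congr_fun (degreeProj_comp_totalMap f (deg x)) (b y)
  rw [LinearMap.comp_apply, LinearMap.comp_apply, hb, if_neg hxy.symm, map_zero] at h1
  rw [← key, h1, map_zero]
  rfl

open PowerSeries in
/-- The Lefschetz series, computed in a homogeneous basis of the total space. -/
theorem lefschetz_eq_sum {κ : Type*} [Fintype κ] [DecidableEq κ]
    (hV : ∀ i, FiniteDimensional k (V i))
    {b : Module.Basis κ k (TotalSpace V)} {deg : κ → ℕ} (hb : IsHomogeneousFamily b deg)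
    (f : V ⟶ V) :
    lefschetz (fun i => (f i).hom) =
      ∑ x, (-1) ^ deg x * X ^ deg x * C (LinearMap.toMatrix b b (totalMap f) x x) := by
  ext i
  rw [lefschetz, coeff_mk, map_sum]
  -- Factoring through the total space lets cyclicity of the trace turn the trace in degree i into
  -- that of the total map composed with the projector to degree i.
  have e1 : (f i).hom = DirectSum.component k ℕ (fun i => (V i : Type x)) i ∘ₗ
      (totalMap f ∘ₗ homog i) := by
    ext a
    simp [DirectSum.component.lof_self]
  have hfin : Module.Finite k (TotalSpace V) := Module.Finite.of_basis b
  rw [e1, LinearMap.trace_comp_comm', LinearMap.comp_assoc]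
  change _ * LinearMap.trace k _ (totalMap f ∘ₗ degreeProj V i) = _
  rw [LinearMap.trace_eq_matrix_trace k b, Matrix.trace, Finset.mul_sum]
  refine Finset.sum_congr rfl fun x _ => ?_
  rw [Matrix.diag_apply, LinearMap.toMatrix_apply, LinearMap.comp_apply, hb]
  have e2 : ((-1) ^ deg x * X ^ deg x * C (LinearMap.toMatrix b b (totalMap f) x x) : k⟦X⟧) =
      C ((-1) ^ deg x * LinearMap.toMatrix b b (totalMap f) x x) * X ^ deg x := by
    simp
    ring
  rw [e2, coeff_C_mul_X_pow, LinearMap.toMatrix_apply]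
  split_ifs with h1 h2 h2
  · rw [h2]
  · exact absurd h1.symm h2
  · exact absurd h2.symm h1
  · simp

end TotalSpace

/-- Averaging over G factors as a retraction onto the invariants followed by their inclusion, so
cyclicity identifies the trace of f composed with the average with the trace on the invariants. -/
theorem trace_restrict_invariants {k : Type*} [Field k] [CharZero k] {G M : Type*} [Group G]
    [Fintype G] [AddCommGroup M] [Module k M] [FiniteDimensional k M] (ρ : Representation k G M)
    (f : M →ₗ[k] M) (hf : ∀ y ∈ ρ.invariants, f y ∈ ρ.invariants) :
    (Fintype.card G : k) * LinearMap.trace k ρ.invariants (f.restrict hf) =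
      ∑ g, LinearMap.trace k M (f ∘ₗ ρ g) := by
  have hc : (Fintype.card G : k) ≠ 0 := Nat.cast_ne_zero.2 Fintype.card_ne_zero
  have := invertibleOfNonzero hc
  let q : M →ₗ[k] ρ.invariants := ρ.averageMap.codRestrict _ ρ.averageMap_invariant
  have hq : ρ.averageMap = ρ.invariants.subtype ∘ₗ q := by
    ext
    rfl
  have hq' : q ∘ₗ ρ.invariants.subtype = LinearMap.id := by
    ext y
    exact ρ.averageMap_id _ y.2
  have h1 : f ∘ₗ ρ.averageMap = ρ.invariants.subtype ∘ₗ (f.restrict hf ∘ₗ q) := by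
    rw [hq]
    ext
    rfl
  have h2 : LinearMap.trace k M (f ∘ₗ ρ.averageMap) =
      LinearMap.trace k ρ.invariants (f.restrict hf) := by
    rw [h1, LinearMap.trace_comp_comm', LinearMap.comp_assoc, hq', LinearMap.comp_id]
  have h3 : (Fintype.card G : k) • ρ.averageMap = ∑ g, ρ g := by
    rw [Representation.averageMap, GroupAlgebra.average, map_smul, smul_smul, mul_invOf_self,
      one_smul, map_sum]
    simp
  have h4 : f ∘ₗ ∑ g, ρ g = ∑ g, f ∘ₗ ρ g :=
    Finset.mul_sum Finset.univ (fun g => (ρ g : Module.End k M)) f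
  rw [← h2, ← smul_eq_mul, ← map_smul, ← LinearMap.comp_smul, h3, h4, map_sum]

end GradedCohomology

/-! ### Total cup products and the unit on a terminal object. -/

namespace GradedCohomology

variable {C : Type v} [Category.{w} C] {k : Type u} [Field k]

section Pullback

variable (H : Cᵒᵖ ⥤ GrVec.{u, x} k)

/-- The pullback on the total space. -/
noncomputable def totalPullback {X Y : C} (f : X ⟶ Y) :
    TotalSpace (H.obj (op Y)) →ₗ[k] TotalSpace (H.obj (op X)) := totalMap (H.map f.op)

theorem totalPullback_homog {X Y : C} (f : X ⟶ Y) (i : ℕ) (a : H.obj (op Y) i) :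
    totalPullback H f (homog i a) = homog (V := H.obj (op X)) i (pullback H f i a) :=
  totalMap_homog _ _ _

theorem totalPullback_comp {X Y Z : C} (f : X ⟶ Y) (g : Y ⟶ Z)
    (a : TotalSpace (H.obj (op Z))) :
    totalPullback H (f ≫ g) a = totalPullback H f (totalPullback H g a) := by
  rw [totalPullback, op_comp, H.map_comp, totalMap_comp]
  rfl

theorem totalPullback_id (X : C) (a : TotalSpace (H.obj (op X))) :
    totalPullback H (𝟙 X) a = a := by
  rw [totalPullback, op_id, H.map_id, totalMap_id]
  rfl

theorem degreeProj_totalPullback {X Y : C} (f : X ⟶ Y) (i : ℕ) (a : TotalSpace (H.obj (op Y))) :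
    degreeProj (H.obj (op X)) i (totalPullback H f a) =
      totalPullback H f (degreeProj (H.obj (op Y)) i a) :=
  LinearMap.congr_fun (degreeProj_comp_totalMap (H.map f.op) i) a

variable {H}

theorem totalPullback_injective_of_comp_eq_id {X Y : C} {f : X ⟶ Y} {s : Y ⟶ X} (h : s ≫ f = 𝟙 Y) :
    Function.Injective (totalPullback H f) := by
  intro a b hab
  rw [← totalPullback_id H Y a, ← totalPullback_id H Y b, ← h, totalPullback_comp,
    totalPullback_comp, hab]

/-- The pullback along an isomorphism. -/
noncomputable def pullbackEquiv {X Y : C} (f : X ≅ Y) :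
    TotalSpace (H.obj (op Y)) ≃ₗ[k] TotalSpace (H.obj (op X)) :=
  LinearEquiv.ofLinearMap (totalPullback H f.hom) (totalPullback H f.inv)
    (LinearMap.ext fun a => by
      rw [LinearMap.comp_apply, ← totalPullback_comp, f.hom_inv_id, totalPullback_id]; rfl)
    (LinearMap.ext fun a => by
      rw [LinearMap.comp_apply, ← totalPullback_comp, f.inv_hom_id, totalPullback_id]; rfl)

end Pullback

namespace CupProduct

variable {H : Cᵒᵖ ⥤ GrVec.{u, x} k} (μ : CupProduct H)

theorem total_homog (X : C) (i j : ℕ) (a : H.obj (op X) i) (b : H.obj (op X) j) :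
    μ.total X (homog i a) (homog j b) = homog (V := H.obj (op X)) (i + j) (μ.cup X i j a b) := by
  simp [CupProduct.total]

theorem totalPullback_total {X Y : C} (f : X ⟶ Y) (a b : TotalSpace (H.obj (op Y))) :
    totalPullback H f (μ.total Y a b) =
      μ.total X (totalPullback H f a) (totalPullback H f b) := by
  suffices h : (μ.total Y).compr₂ (totalPullback H f) =
      (μ.total X).compl₁₂ (totalPullback H f) (totalPullback H f) from LinearMap.congr_fun₂ h a b
  refine DirectSum.linearMap_ext _ fun i => LinearMap.ext fun a =>
    DirectSum.linearMap_ext _ fun j => LinearMap.ext fun b => ?_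
  simp only [LinearMap.comp_apply, LinearMap.compr₂_apply, LinearMap.compl₁₂_apply,
    total_homog, totalPullback_homog, μ.natural]

theorem total_assoc (X : C) (a b c : TotalSpace (H.obj (op X))) :
    μ.total X (μ.total X a b) c = μ.total X a (μ.total X b c) := by
  induction a using DirectSum.induction_on with
  | zero => simp
  | add a a' ha ha' => simp [ha, ha']
  | of i a =>
    induction b using DirectSum.induction_on with
    | zero => simp
    | add b b' hb hb' => simp [hb, hb']
    | of j b =>
      induction c using DirectSum.induction_on with
      | zero => simp
      | add c c' hc hc' => simp [hc, hc']
      | of l c =>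
        change μ.total X (μ.total X (homog i a) (homog j b)) (homog l c) =
          μ.total X (homog i a) (μ.total X (homog j b) (homog l c))
        simp only [total_homog, μ.assoc]

theorem total_comm (X : C) {i j : ℕ} (a : H.obj (op X) i) (b : H.obj (op X) j) :
    μ.total X (homog i a) (homog j b) =
      (-1 : k) ^ (i * j) • μ.total X (homog j b) (homog i a) := by
  rw [total_homog, total_homog, μ.comm]

theorem totalPullback_iter {Y Z : C} (f : Y ⟶ Z) (n : ℕ)
    (a : Fin (n + 1) → TotalSpace (H.obj (op Z))) :
    totalPullback H f (μ.iter Z n a) = μ.iter Y n fun j => totalPullback H f (a j) := by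
  induction n with
  | zero => rfl
  | succ n ih =>
    rw [iter, iter, totalPullback_total, ih]

variable {μ} [HasFiniteProducts C]

theorem Kunneth.exists_equiv (hK : μ.Kunneth) (X Y : C) :
    ∃ e : TotalSpace (H.obj (op X)) ⊗[k] TotalSpace (H.obj (op Y)) ≃ₗ[k]
      TotalSpace (H.obj (op (X ⨯ Y))), ∀ a b, e (a ⊗ₜ b) =
        μ.total (X ⨯ Y) (totalPullback H prod.fst a) (totalPullback H prod.snd b) := by
  obtain ⟨e, he⟩ := hK X Y
  refine ⟨e.symm, fun a b => ?_⟩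
  suffices h : (TensorProduct.mk k _ _).compr₂ (e.symm : _ →ₗ[k] _) =
      (μ.total (X ⨯ Y)).compl₁₂ (totalPullback H prod.fst) (totalPullback H prod.snd) from
    LinearMap.congr_fun₂ h a b
  refine DirectSum.linearMap_ext _ fun i => LinearMap.ext fun a =>
    DirectSum.linearMap_ext _ fun j => LinearMap.ext fun b => ?_
  simp only [LinearMap.comp_apply, LinearMap.compr₂_apply, LinearMap.compl₁₂_apply,
    total_homog, totalPullback_homog, TensorProduct.mk_apply, LinearEquiv.coe_coe]
  rw [← he, LinearEquiv.symm_apply_apply]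

/-- Let m be the least degree in which H(Y) is nonzero. Pullback embeds H^m(Y) into H^m(Y × T),
because the projection has a section. If H^0(T) vanished, Künneth would leave nothing in degree m of
H(Y × T). -/
theorem Kunneth.exists_terminal_ne_zero (hK : μ.Kunneth)
    (hH : ∃ (Y : C) (i : ℕ), Nontrivial (H.obj (op Y) i)) {T : C} (hT : IsTerminal T) :
    ∃ e : H.obj (op T) 0, e ≠ 0 := by
  classical
  by_contra! h0
  obtain ⟨Y, hY⟩ := hH
  have := Nat.find_spec hY
  obtain ⟨y, hy⟩ := exists_ne (0 : H.obj (op Y) (Nat.find hY))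
  have hlt : ∀ i < Nat.find hY, ∀ a : H.obj (op Y) i, a = 0 := by
    intro i hi a
    by_contra ha
    exact Nat.find_min hY hi ⟨a, 0, ha⟩
  obtain ⟨E, hE⟩ := hK.exists_equiv Y T
  -- A product of degrees i + j = m has j = 0 or i < m; either way a factor vanishes.
  have hz : degreeProj (H.obj (op (Y ⨯ T))) (Nat.find hY) ∘ₗ E.toLinearMap = 0 := by
    refine TensorProduct.ext (DirectSum.linearMap_ext _ fun i => LinearMap.ext fun a =>
      DirectSum.linearMap_ext _ fun j => LinearMap.ext fun b => ?_)
    change degreeProj _ _ (E (homog i a ⊗ₜ homog j b)) = 0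
    rw [hE, totalPullback_homog, totalPullback_homog, total_homog, degreeProj_homog]
    split_ifs with hij
    · rcases Nat.eq_zero_or_pos j with rfl | hj
      · rw [h0 b, map_zero, map_zero, map_zero]
      · rw [hlt i (by omega) a, map_zero, map_zero, LinearMap.zero_apply, map_zero]
    · rfl
  have h1 := degreeProj_totalPullback H (prod.fst : Y ⨯ T ⟶ Y) (Nat.find hY) (homog _ y)
  rw [degreeProj_homog_self] at h1
  have h2 := LinearMap.congr_fun hz (E.symm (totalPullback H prod.fst (homog _ y)))
  rw [LinearMap.comp_apply, LinearEquiv.coe_coe, LinearEquiv.apply_symm_apply, h1,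
    LinearMap.zero_apply] at h2
  have hinj := totalPullback_injective_of_comp_eq_id (H := H)
    (prod.lift_fst (𝟙 Y) (hT.from Y))
  exact hy (homog_injective _ (hinj (by rw [h2, map_zero, map_zero])))

/-- The cohomology of a terminal object is spanned by a unit for the cup product. -/
theorem Kunneth.exists_unit (hK : μ.Kunneth)
    (hH : ∃ (Y : C) (i : ℕ), Nontrivial (H.obj (op Y) i)) {T : C} (hT : IsTerminal T) :
    ∃ e : H.obj (op T) 0, homog (V := H.obj (op T)) 0 e ≠ 0 ∧
      (∀ z : TotalSpace (H.obj (op T)), ∃ c : k, z = c • homog (V := H.obj (op T)) 0 e) ∧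
      ∀ (Y : C) (f : Y ⟶ T) (y : TotalSpace (H.obj (op Y))),
        μ.total Y (totalPullback H f (homog 0 e)) y = y := by
  obtain ⟨e₀, he₀⟩ := hK.exists_terminal_ne_zero hH hT
  have hne : homog (V := H.obj (op T)) 0 e₀ ≠ 0 := fun h =>
    he₀ (homog_injective _ (h.trans (map_zero _).symm))
  obtain ⟨f, hf⟩ := Module.Projective.exists_dual_ne_zero k hne
  obtain ⟨E, hE⟩ := hK.exists_equiv T T
  -- The two projections of T × T coincide, so the Künneth map factors through the cup product of T.
  have hE' : ∀ a b, E (a ⊗ₜ b) = totalPullback H prod.fst (μ.total T a b) := by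
    intro a b
    rw [hE, totalPullback_total, hT.hom_ext (prod.snd : T ⨯ T ⟶ T) prod.fst]
  have hcomm : ∀ z : TotalSpace (H.obj (op T)),
      μ.total T z (homog 0 e₀) = μ.total T (homog 0 e₀) z := by
    intro z
    induction z using DirectSum.induction_on with
    | zero => simp
    | add a b ha hb => simp [ha, hb]
    | of i a =>
      change μ.total T (homog i a) _ = μ.total T _ (homog i a)
      rw [total_comm]
      simp
  have hspan : ∀ z : TotalSpace (H.obj (op T)), ∃ c : k,
      z = c • homog (V := H.obj (op T)) 0 e₀ := by
    intro z
    -- Degree-0 elements commute with everything, so the injective Künneth map identifies z ⊗ e₀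
    -- with e₀ ⊗ z; contracting with `f` makes z a multiple of e₀.
    have h1 : z ⊗ₜ[k] homog (V := H.obj (op T)) 0 e₀ = homog (V := H.obj (op T)) 0 e₀ ⊗ₜ[k] z := by
      apply E.injective
      rw [hE', hE', hcomm]
    have h2 := congrArg (TensorProduct.rid k _ ∘ LinearMap.lTensor _ f) h1
    refine ⟨f z / f (homog 0 e₀), ?_⟩
    simp only [Function.comp_apply, LinearMap.lTensor_tmul, TensorProduct.rid_tmul] at h2
    rw [div_eq_inv_mul, mul_smul, ← h2, smul_smul, inv_mul_cancel₀ hf, one_smul]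
  obtain ⟨c, hc⟩ := hspan (μ.total T (homog 0 e₀) (homog 0 e₀))
  have hc0 : c ≠ 0 := by
    rintro rfl
    rw [zero_smul] at hc
    have h1 : homog (V := H.obj (op T)) 0 e₀ ⊗ₜ[k] homog (V := H.obj (op T)) 0 e₀ = 0 := by
      apply E.injective
      rw [hE', hc, map_zero, map_zero]
    have h2 := congrArg (LinearMap.mul' k k ∘ₗ TensorProduct.map f f) h1
    simp [hf] at h2
  -- Since e₀ ∪ e₀ = c e₀ with c ≠ 0, this rescaling is idempotent.
  refine ⟨c⁻¹ • e₀, ?_, fun z => ?_, fun Y f y => ?_⟩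
  · rw [map_smul]
    exact smul_ne_zero (inv_ne_zero hc0) hne
  · obtain ⟨a, ha⟩ := hspan z
    refine ⟨a * c, ?_⟩
    rw [map_smul, smul_smul, mul_assoc, mul_inv_cancel₀ hc0, mul_one, ha]
  · set e := homog (V := H.obj (op T)) 0 (c⁻¹ • e₀) with he
    have hee : μ.total T e e = e := by
      rw [he, map_smul, map_smul, map_smul, LinearMap.smul_apply, hc, smul_smul, smul_smul]
      congr 1
      field_simp
    obtain ⟨E', hE''⟩ := hK.exists_equiv T Y
    have hsurj : ∀ w : TotalSpace (H.obj (op (T ⨯ Y))), ∃ z,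
        w = μ.total _ (totalPullback H prod.fst e) (totalPullback H prod.snd z) := by
      intro w
      obtain ⟨t, rfl⟩ := E'.surjective w
      induction t with
      | zero => exact ⟨0, by simp⟩
      | add t t' ht ht' =>
        obtain ⟨z, hz⟩ := ht
        obtain ⟨z', hz'⟩ := ht'
        exact ⟨z + z', by rw [map_add, hz, hz']; simp⟩
      | tmul a b =>
        obtain ⟨r, rfl⟩ := hspan a
        refine ⟨(r * c) • b, ?_⟩
        rw [hE'', he]
        simp only [map_smul, LinearMap.smul_apply, smul_smul]
        congr 1
        field_simp
    -- Pulling back along (f, id) writes y as f^*e ∪ z, and idempotence of e then gives f^*e ∪ y =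
    -- y.
    obtain ⟨z, hz⟩ := hsurj (totalPullback H prod.snd y)
    have hz' := congrArg (totalPullback H (prod.lift f (𝟙 Y))) hz
    rw [totalPullback_total, ← totalPullback_comp, ← totalPullback_comp, ← totalPullback_comp,
      prod.lift_fst, prod.lift_snd, totalPullback_id, totalPullback_id] at hz'
    rw [hz', ← total_assoc, ← totalPullback_total, hee]

end CupProduct

end GradedCohomology

/-! ### Cohomology of powers as tensor powers, and the induced endomorphism. -/

namespace GradedCohomology

variable {C : Type v} [Category.{w} C] [HasFiniteProducts C] {k : Type u} [Field k]

section Powers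

/-- The projection to the first `n` factors. -/
noncomputable def initProj (X : C) (n : ℕ) : power X (n + 1) ⟶ power X n :=
  Pi.lift fun j => proj X (n + 1) j.castSucc

@[simp]
theorem initProj_proj (X : C) (n : ℕ) (j : Fin n) :
    initProj X n ≫ proj X n j = proj X (n + 1) j.castSucc := by
  simp [initProj]

/-- `X ^ (n + 1)` is the product of `X ^ n` and `X`. -/
noncomputable def powerSuccIso (X : C) (n : ℕ) : power X (n + 1) ≅ power X n ⨯ X where
  hom := prod.lift (initProj X n) (proj X (n + 1) (Fin.last n))
  inv := Pi.lift (Fin.lastCases prod.snd fun j => prod.fst ≫ proj X n j)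
  hom_inv_id := by
    apply Pi.hom_ext
    intro j
    rw [Category.assoc, Pi.lift_π, Category.id_comp]
    induction j using Fin.lastCases with
    | last =>
      rw [Fin.lastCases_last]
      exact prod.lift_snd _ _
    | cast j =>
      rw [Fin.lastCases_castSucc]
      exact (prod.lift_fst_assoc _ _ _).trans (initProj_proj X n j)
  inv_hom_id := by
    rw [prod.comp_lift]
    apply Limits.prod.hom_ext
    · rw [prod.lift_fst, Category.id_comp]
      apply Pi.hom_ext
      intro j
      rw [Category.assoc, initProj_proj, Pi.lift_π, Fin.lastCases_castSucc]
    · rw [prod.lift_snd, Category.id_comp, Pi.lift_π, Fin.lastCases_last]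

/-- `X ^ 0` is terminal. -/
noncomputable def powerZeroIsTerminal (X : C) : IsTerminal (power X 0) :=
  IsTerminal.ofUniqueHom (fun _ => Pi.lift fun j => j.elim0) fun _ _ =>
    Pi.hom_ext _ _ fun j => j.elim0

@[simp]
theorem permute_proj (X : C) (n : ℕ) (σ : Equiv.Perm (Fin n)) (j : Fin n) :
    permute X n σ ≫ proj X n j = proj X n (σ j) := by
  simp [permute]

theorem permute_extendLast_initProj (X : C) (n : ℕ) (τ : Equiv.Perm (Fin n)) :
    permute X (n + 1) (extendLast n τ) ≫ initProj X n = initProj X n ≫ permute X n τ := by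
  apply Pi.hom_ext
  intro j
  simp

theorem permute_extendLast_proj_last (X : C) (n : ℕ) (τ : Equiv.Perm (Fin n)) :
    permute X (n + 1) (extendLast n τ) ≫ proj X (n + 1) (Fin.last n) =
      proj X (n + 1) (Fin.last n) := by
  simp

theorem permute_swapLastTwo_initProj (X : C) (n : ℕ) :
    permute X (n + 2) (swapLastTwo n) ≫ initProj X (n + 1) ≫ initProj X n =
      initProj X (n + 1) ≫ initProj X n := by
  apply Pi.hom_ext
  intro j
  have h1 : j.castSucc.castSucc ≠ (Fin.last n).castSucc := by
    simp [Fin.ext_iff, j.2.ne]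
  have h2 : j.castSucc.castSucc ≠ Fin.last (n + 1) := (Fin.castSucc_lt_last _).ne
  simp [swapLastTwo, Equiv.swap_apply_of_ne_of_ne h1 h2]

theorem permute_swapLastTwo_proj_castSucc (X : C) (n : ℕ) :
    permute X (n + 2) (swapLastTwo n) ≫ initProj X (n + 1) ≫ proj X (n + 1) (Fin.last n) =
      proj X (n + 2) (Fin.last (n + 1)) := by
  simp [swapLastTwo]

theorem permute_swapLastTwo_proj_last (X : C) (n : ℕ) :
    permute X (n + 2) (swapLastTwo n) ≫ proj X (n + 2) (Fin.last (n + 1)) =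
      initProj X (n + 1) ≫ proj X (n + 1) (Fin.last n) := by
  simp [swapLastTwo]

end Powers

variable {H : Cᵒᵖ ⥤ GrVec.{u, x} k} {μ : CupProduct H} {X : C}

/-- The Künneth isomorphisms `H^•(X ^ n) ⊗ H^•(X) ≃ H^•(X ^ (n + 1))` and the unit that spans
`H^•(X ^ 0)`. -/
structure PowerData (μ : CupProduct H) (X : C) where
  equiv (n : ℕ) : TotalSpace (H.obj (op (power X n))) ⊗[k] TotalSpace (H.obj (op X)) ≃ₗ[k]
    TotalSpace (H.obj (op (power X (n + 1))))
  equiv_tmul (n : ℕ) (a : TotalSpace (H.obj (op (power X n)))) (b : TotalSpace (H.obj (op X))) :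
    equiv n (a ⊗ₜ b) = μ.total _ (totalPullback H (initProj X n) a)
      (totalPullback H (proj X (n + 1) (Fin.last n)) b)
  unit : H.obj (op (power X 0)) 0
  unit_ne_zero : homog (V := H.obj (op (power X 0))) 0 unit ≠ 0
  span (z : TotalSpace (H.obj (op (power X 0)))) :
    ∃ c : k, z = c • homog (V := H.obj (op (power X 0))) 0 unit
  total_unit (Y : C) (f : Y ⟶ power X 0) (y : TotalSpace (H.obj (op Y))) :
    μ.total Y (totalPullback H f (homog 0 unit)) y = y

theorem CupProduct.Kunneth.nonempty_powerData (hK : μ.Kunneth)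
    (hH : ∃ (Y : C) (i : ℕ), Nontrivial (H.obj (op Y) i)) (X : C) :
    Nonempty (PowerData μ X) := by
  obtain ⟨e, h1, h2, h3⟩ := hK.exists_unit hH (powerZeroIsTerminal X)
  choose E hE using fun n => hK.exists_equiv (power X n) X
  refine ⟨⟨fun n => (E n).trans (pullbackEquiv (powerSuccIso X n)), fun n a b => ?_,
    e, h1, h2, h3⟩⟩
  change totalPullback H (prod.lift _ _) (E n (a ⊗ₜ b)) = _
  rw [hE, CupProduct.totalPullback_total, ← totalPullback_comp, ← totalPullback_comp,
    prod.lift_fst, prod.lift_snd]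

namespace PowerData

variable (D : PowerData μ X)

/-- The product `p_1^*(v_1) ∪ ⋯ ∪ p_n^*(v_n)`. -/
noncomputable def pure : ∀ n, (Fin n → TotalSpace (H.obj (op X))) →
    TotalSpace (H.obj (op (power X n)))
  | 0, _ => homog 0 D.unit
  | n + 1, v => D.equiv n (pure n (fun j => v j.castSucc) ⊗ₜ v (Fin.last n))

theorem iter_eq_pure (n : ℕ) (v : Fin (n + 1) → TotalSpace (H.obj (op X))) :
    μ.iter (power X (n + 1)) n (fun j => totalPullback H (proj X (n + 1) j) (v j)) =
      D.pure (n + 1) v := by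
  induction n with
  | zero =>
    rw [pure, pure, D.equiv_tmul, D.total_unit]
    rfl
  | succ n ih =>
    rw [pure, D.equiv_tmul, ← ih, CupProduct.totalPullback_iter, CupProduct.iter]
    simp_rw [← totalPullback_comp, initProj_proj]

/-- Products of homogeneous classes span H^•(X^n); this gives uniqueness of the induced
endomorphism. -/
theorem hom_ext {n : ℕ} {Z : Type*} [AddCommGroup Z] [Module k Z]
    {F F' : TotalSpace (H.obj (op (power X n))) →ₗ[k] Z}
    (h : ∀ v : Fin n → TotalSpace (H.obj (op X)),
      (∀ j, ∃ (i : ℕ) (a : H.obj (op X) i), v j = homog (V := H.obj (op X)) i a) →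
      F (D.pure n v) = F' (D.pure n v)) : F = F' := by
  induction n with
  | zero =>
    refine LinearMap.ext fun z => ?_
    obtain ⟨c, rfl⟩ := D.span z
    rw [map_smul, map_smul]
    exact congrArg _ (h Fin.elim0 fun j => j.elim0)
  | succ n ih =>
    have key : F ∘ₗ (D.equiv n).toLinearMap = F' ∘ₗ (D.equiv n).toLinearMap := by
      suffices h2 : ((TensorProduct.mk k _ _).compr₂ (F ∘ₗ (D.equiv n).toLinearMap)).flip =
          ((TensorProduct.mk k _ _).compr₂ (F' ∘ₗ (D.equiv n).toLinearMap)).flip from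
        TensorProduct.ext' fun a b => LinearMap.congr_fun₂ h2 b a
      refine DirectSum.linearMap_ext _ fun i => LinearMap.ext fun a => ih fun v hv => ?_
      have := h (Fin.snoc (α := fun _ => TotalSpace (H.obj (op X))) v (homog i a)) fun j => by
        induction j using Fin.lastCases with
        | last => exact ⟨i, a, by simp⟩
        | cast j => simpa using hv j
      simpa [pure] using this
    refine LinearMap.ext fun z => ?_
    obtain ⟨t, rfl⟩ := (D.equiv n).surjective z
    exact LinearMap.congr_fun key t

/-- The endomorphism of `H^•(X ^ n)` induced by an endomorphism of `H^•(X)`. -/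
noncomputable def endo (φ : H.obj (op X) ⟶ H.obj (op X)) : ∀ n,
    TotalSpace (H.obj (op (power X n))) →ₗ[k] TotalSpace (H.obj (op (power X n)))
  | 0 => LinearMap.id
  | n + 1 => (D.equiv n).toLinearMap ∘ₗ TensorProduct.map (endo φ n) (totalMap φ) ∘ₗ
      (D.equiv n).symm.toLinearMap

theorem endo_equiv (φ : H.obj (op X) ⟶ H.obj (op X)) (n : ℕ)
    (t : TotalSpace (H.obj (op (power X n))) ⊗[k] TotalSpace (H.obj (op X))) :
    D.endo φ (n + 1) (D.equiv n t) =
      D.equiv n (TensorProduct.map (D.endo φ n) (totalMap φ) t) := by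
  simp [endo]

theorem endo_pure (φ : H.obj (op X) ⟶ H.obj (op X)) (n : ℕ)
    (v : Fin n → TotalSpace (H.obj (op X))) :
    D.endo φ n (D.pure n v) = D.pure n fun j => totalMap φ (v j) := by
  induction n with
  | zero => rfl
  | succ n ih => rw [pure, endo_equiv, TensorProduct.map_tmul, ih, pure]

theorem degreeProj_equiv (n i j l : ℕ) (a : H.obj (op (power X n)) i) (b : H.obj (op X) j) :
    degreeProj _ l (D.equiv n (homog i a ⊗ₜ homog j b)) =
      if i + j = l then D.equiv n (homog i a ⊗ₜ homog j b) else 0 := by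
  rw [D.equiv_tmul, totalPullback_homog, totalPullback_homog, CupProduct.total_homog,
    degreeProj_homog]

/-- By induction the map on n factors is graded, and Künneth adds degrees, so tensoring with φ
preserves total degree. -/
theorem degreeProj_comp_endo (φ : H.obj (op X) ⟶ H.obj (op X)) (n l : ℕ) :
    degreeProj _ l ∘ₗ D.endo φ n = D.endo φ n ∘ₗ degreeProj _ l := by
  induction n generalizing l with
  | zero => rfl
  | succ n ih =>
    obtain ⟨Φ, hΦ⟩ := exists_totalMap_eq (D.endo φ n) ih
    have key : (degreeProj _ l ∘ₗ D.endo φ (n + 1)) ∘ₗ (D.equiv n).toLinearMap =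
        (D.endo φ (n + 1) ∘ₗ degreeProj _ l) ∘ₗ (D.equiv n).toLinearMap := by
      refine TensorProduct.ext (DirectSum.linearMap_ext _ fun i => LinearMap.ext fun a =>
        DirectSum.linearMap_ext _ fun j => LinearMap.ext fun b => ?_)
      change degreeProj _ l (D.endo φ (n + 1) (D.equiv n (homog i a ⊗ₜ homog j b))) =
        D.endo φ (n + 1) (degreeProj _ l (D.equiv n (homog i a ⊗ₜ homog j b)))
      rw [degreeProj_equiv, endo_equiv, TensorProduct.map_tmul, ← hΦ, totalMap_homog,
        totalMap_homog, degreeProj_equiv]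
      split_ifs
      · rw [endo_equiv, TensorProduct.map_tmul, ← hΦ, totalMap_homog, totalMap_homog]
      · rw [map_zero]
    refine LinearMap.ext fun z => ?_
    obtain ⟨t, rfl⟩ := (D.equiv n).surjective z
    exact LinearMap.congr_fun key t

theorem isInduced_iff (φ : H.obj (op X) ⟶ H.obj (op X)) (n : ℕ)
    (Φ : H.obj (op (power X n)) ⟶ H.obj (op (power X n))) :
    μ.IsInduced φ n Φ ↔ totalMap Φ = D.endo φ n := by
  cases n with
  | zero =>
    rw [CupProduct.IsInduced, endo, ← totalMap_id]
    exact ⟨fun h => congrArg _ h, totalMap_injective⟩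
  | succ n =>
    rw [CupProduct.IsInduced]
    simp_rw [← totalPullback_homog, ← totalMap_homog, D.iter_eq_pure]
    constructor
    · intro h
      refine D.hom_ext fun v hv => ?_
      choose d a ha using hv
      obtain rfl : v = fun j => homog (d j) (a j) := funext ha
      rw [h, endo_pure]
    · intro h d a
      rw [h, endo_pure]

theorem existsUnique_isInduced (D : PowerData μ X) (φ : H.obj (op X) ⟶ H.obj (op X)) (n : ℕ) :
    ∃! Φ, μ.IsInduced φ n Φ := by
  obtain ⟨Φ, hΦ⟩ := exists_totalMap_eq (D.endo φ n) (D.degreeProj_comp_endo φ n)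
  refine ⟨Φ, (D.isInduced_iff φ n Φ).2 hΦ, fun Ψ hΨ => totalMap_injective ?_⟩
  rw [hΦ, (D.isInduced_iff φ n Ψ).1 hΨ]

theorem permute_extendLast_equiv (n : ℕ) (τ : Equiv.Perm (Fin n))
    (t : TotalSpace (H.obj (op (power X n))) ⊗[k] TotalSpace (H.obj (op X))) :
    totalPullback H (permute X (n + 1) (extendLast n τ)) (D.equiv n t) =
      D.equiv n (TensorProduct.map (totalPullback H (permute X n τ)) LinearMap.id t) := by
  induction t with
  | zero => simp
  | add s t hs ht => simp only [map_add, hs, ht]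
  | tmul a b =>
    rw [TensorProduct.map_tmul, D.equiv_tmul, D.equiv_tmul, CupProduct.totalPullback_total,
      ← totalPullback_comp, ← totalPullback_comp, ← totalPullback_comp,
      permute_extendLast_initProj, permute_extendLast_proj_last]
    rfl

/-- The geometric swap exchanges the last two pullbacks; graded commutativity restores their order
and produces the Koszul sign. -/
theorem permute_swapLastTwo_equiv (n i j : ℕ) (y : TotalSpace (H.obj (op (power X n))))
    (a : H.obj (op X) i) (b : H.obj (op X) j) :
    totalPullback H (permute X (n + 2) (swapLastTwo n))
        (D.equiv (n + 1) (D.equiv n (y ⊗ₜ homog i a) ⊗ₜ homog j b)) =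
      (-1 : k) ^ (i * j) • D.equiv (n + 1) (D.equiv n (y ⊗ₜ homog j b) ⊗ₜ homog i a) := by
  simp only [D.equiv_tmul, CupProduct.totalPullback_total, ← totalPullback_comp,
    permute_swapLastTwo_initProj, permute_swapLastTwo_proj_castSucc,
    permute_swapLastTwo_proj_last, CupProduct.total_assoc]
  rw [totalPullback_homog, totalPullback_homog, CupProduct.total_comm, map_smul]

end PowerData

end GradedCohomology

/-! ### Kronecker powers of diagonal matrices and change of scalars. -/

/-- The index of `x ⊗ a`. -/
def PowerIndex.succEquiv (ι : Type*) (n : ℕ) : PowerIndex ι n × ι ≃ PowerIndex ι (n + 1) :=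
  Equiv.refl _

instance PowerIndex.uniqueZero (ι : Type*) : Unique (PowerIndex ι 0) :=
  inferInstanceAs (Unique PUnit)

/-- The degree of an element of the basis of the `n`-th tensor power. -/
def PowerIndex.degree {ι : Type*} (deg : ι → ℕ) : ∀ n, PowerIndex ι n → ℕ
  | 0, _ => 0
  | n + 1, p => PowerIndex.degree deg n p.1 + deg p.2

section KroneckerPow

open Matrix

variable {R S : Type*} [CommRing R] [CommRing S] {ι : Type*}

theorem kron_apply {n : ℕ} (A : Matrix (PowerIndex ι n) (PowerIndex ι n) R) (B : Matrix ι ι R)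
    (x y : PowerIndex ι n) (a c : ι) :
    kron A B (PowerIndex.succEquiv ι n (x, a)) (PowerIndex.succEquiv ι n (y, c)) =
      A x y * B a c := rfl

theorem kron_map {n : ℕ} (f : R →+* S) (A : Matrix (PowerIndex ι n) (PowerIndex ι n) R)
    (B : Matrix ι ι R) : (kron A B).map f = kron (A.map f) (B.map f) := by
  ext p q
  exact map_mul f _ _

variable [DecidableEq ι]

theorem powSuperSwap_apply [Fintype ι] (deg : ι → ℕ) (n : ℕ) (p : PowerIndex ι (n + 2))
    (y : PowerIndex ι n) (c d : ι) :
    powSuperSwap R deg n p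
        (PowerIndex.succEquiv ι (n + 1) (PowerIndex.succEquiv ι n (y, c), d)) =
      if p = PowerIndex.succEquiv ι (n + 1) (PowerIndex.succEquiv ι n (y, d), c) then
        (-1) ^ (deg c * deg d) else 0 := rfl

theorem kroneckerPow_mul [Fintype ι] (A B : Matrix ι ι R) (n : ℕ) :
    kroneckerPow (A * B) n = kroneckerPow A n * kroneckerPow B n := by
  induction n with
  | zero => exact (mul_one _).symm
  | succ n ih => rw [kroneckerPow_succ, ih, ← kron_mul_kron]; rfl

theorem kroneckerPow_map (f : R →+* S) (A : Matrix ι ι R) (n : ℕ) :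
    (kroneckerPow A n).map f = kroneckerPow (A.map f) n := by
  induction n with
  | zero => exact Matrix.map_one f f.map_zero f.map_one
  | succ n ih => rw [kroneckerPow_succ, kron_map, ih]; rfl

/-- Used with r = -1 for the supertrace signs and with r = u for the weights. -/
theorem kroneckerPow_diagonal_pow (r : R) (deg : ι → ℕ) (n : ℕ) :
    kroneckerPow (diagonal fun a => r ^ deg a) n =
      diagonal fun x => r ^ PowerIndex.degree deg n x := by
  induction n with
  | zero =>
    change (1 : Matrix (PowerIndex ι 0) (PowerIndex ι 0) R) = diagonal fun _ => r ^ 0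
    simp
  | succ n ih =>
    rw [kroneckerPow_succ, ih]
    ext ⟨x, a⟩ ⟨y, c⟩
    change (diagonal _ : Matrix (PowerIndex ι n) (PowerIndex ι n) R) x y *
      (diagonal _ : Matrix ι ι R) a c =
      (diagonal (fun p : PowerIndex ι n × ι => r ^ (PowerIndex.degree deg n p.1 + deg p.2)) :
        Matrix (PowerIndex ι n × ι) (PowerIndex ι n × ι) R) (x, a) (y, c)
    simp only [diagonal_apply, Prod.mk.injEq]
    by_cases h1 : x = y <;> by_cases h2 : a = c <;> simp [h1, h2, pow_add]

theorem IsKoszulAction.map [Fintype ι] {deg : ι → ℕ}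
    {ρ : ∀ n, Equiv.Perm (Fin n) →* Matrix (PowerIndex ι n) (PowerIndex ι n) R}
    (hρ : IsKoszulAction deg ρ) (f : R →+* S) :
    IsKoszulAction deg fun n =>
      (f.mapMatrix : Matrix (PowerIndex ι n) (PowerIndex ι n) R →+* Matrix _ _ S).toMonoidHom.comp (ρ n) where
  extendLast n τ := by
    change (ρ (n + 1) (_root_.extendLast n τ)).map f = kron ((ρ n τ).map f) 1
    rw [hρ.extendLast, kron_map, Matrix.map_one f f.map_zero f.map_one]
  swapLastTwo n := by
    change (ρ (n + 2) (_root_.swapLastTwo n)).map f = _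
    rw [hρ.swapLastTwo]
    ext p q
    obtain ⟨⟨q, y⟩, rfl⟩ := (PowerIndex.succEquiv ι (n + 1)).surjective q
    obtain ⟨⟨q, x⟩, rfl⟩ := (PowerIndex.succEquiv ι n).surjective q
    rw [Matrix.map_apply, powSuperSwap_apply, powSuperSwap_apply, apply_ite f]
    simp

end KroneckerPow

/-! ### Matrices of the induced endomorphism and of the permutations. -/

namespace GradedCohomology

variable {C : Type v} [Category.{w} C] [HasFiniteProducts C] {k : Type u} [Field k]
  {H : Cᵒᵖ ⥤ GrVec.{u, x} k} {μ : CupProduct H} {X : C}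

namespace PowerData

variable (D : PowerData μ X) {ι : Type*} (b : Module.Basis ι k (TotalSpace (H.obj (op X))))

/-- The basis of `H^•(X ^ n)` given by a basis of `H^•(X)`. -/
noncomputable def basis : ∀ n, Module.Basis (PowerIndex ι n) k
    (TotalSpace (H.obj (op (power X n))))
  | 0 => Module.Basis.mk (v := fun _ : PowerIndex ι 0 => homog 0 D.unit)
      (linearIndependent_unique_iff.2 D.unit_ne_zero) fun z _ => by
        obtain ⟨c, rfl⟩ := D.span z
        exact Submodule.smul_mem _ _ (Submodule.subset_span ⟨default, rfl⟩)
  | n + 1 => (((basis n).tensorProduct b).map (D.equiv n)).reindex (PowerIndex.succEquiv ι n)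

theorem basis_zero (x : PowerIndex ι 0) : D.basis b 0 x = homog 0 D.unit := by
  rw [basis, Module.Basis.mk_apply]

theorem basis_succ (n : ℕ) (x : PowerIndex ι n) (a : ι) :
    D.basis b (n + 1) (PowerIndex.succEquiv ι n (x, a)) = D.equiv n (D.basis b n x ⊗ₜ b a) := by
  simp [basis]

theorem basis_repr_equiv (n : ℕ)
    (t : TotalSpace (H.obj (op (power X n))) ⊗[k] TotalSpace (H.obj (op X)))
    (x : PowerIndex ι n) (a : ι) :
    (D.basis b (n + 1)).repr (D.equiv n t) (PowerIndex.succEquiv ι n (x, a)) =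
      ((D.basis b n).tensorProduct b).repr t (x, a) := by
  simp [basis]

theorem exists_eq_homog {V : GrVec.{u, x} k} {κ : Type*} {b : κ → TotalSpace V} {deg : κ → ℕ}
    (hb : IsHomogeneousFamily b deg) (x : κ) : ∃ a : V (deg x), b x = homog (deg x) a :=
  ⟨_, ((hb x (deg x)).trans (if_pos rfl)).symm⟩

variable {b} {deg : ι → ℕ} (hb : IsHomogeneousFamily b deg)

include hb in
theorem isHomogeneousFamily_basis (n : ℕ) :
    IsHomogeneousFamily (D.basis b n) (PowerIndex.degree deg n) := by
  induction n with
  | zero =>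
    intro x i
    rw [basis_zero, degreeProj_homog]
    rfl
  | succ n ih =>
    intro p i
    obtain ⟨⟨x, y⟩, rfl⟩ := (PowerIndex.succEquiv ι n).surjective p
    obtain ⟨a, ha⟩ := exists_eq_homog ih x
    obtain ⟨c, hc⟩ := exists_eq_homog hb y
    rw [basis_succ, ha, hc, degreeProj_equiv]
    rfl

variable [Fintype ι] [DecidableEq ι]

theorem toMatrix_eq_kron (n : ℕ)
    {F : TotalSpace (H.obj (op (power X (n + 1)))) →ₗ[k] TotalSpace (H.obj (op (power X (n + 1))))}
    {f : TotalSpace (H.obj (op (power X n))) →ₗ[k] TotalSpace (H.obj (op (power X n)))}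
    {g : TotalSpace (H.obj (op X)) →ₗ[k] TotalSpace (H.obj (op X))}
    (h : ∀ t, F (D.equiv n t) = D.equiv n (TensorProduct.map f g t)) :
    LinearMap.toMatrix (D.basis b (n + 1)) (D.basis b (n + 1)) F =
      kron (LinearMap.toMatrix (D.basis b n) (D.basis b n) f) (LinearMap.toMatrix b b g) := by
  ext p q
  obtain ⟨⟨x, a⟩, rfl⟩ := (PowerIndex.succEquiv ι n).surjective p
  obtain ⟨⟨y, c⟩, rfl⟩ := (PowerIndex.succEquiv ι n).surjective q
  rw [LinearMap.toMatrix_apply, basis_succ, h, basis_repr_equiv, TensorProduct.map_tmul,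
    kron_apply, LinearMap.toMatrix_apply, LinearMap.toMatrix_apply,
    Module.Basis.tensorProduct_repr_tmul_apply, smul_eq_mul, mul_comm]

theorem toMatrix_endo (φ : H.obj (op X) ⟶ H.obj (op X)) (n : ℕ) :
    LinearMap.toMatrix (D.basis b n) (D.basis b n) (D.endo φ n) =
      kroneckerPow (LinearMap.toMatrix b b (totalMap φ)) n := by
  induction n with
  | zero => exact LinearMap.toMatrix_id _
  | succ n ih => rw [D.toMatrix_eq_kron n (D.endo_equiv φ n), ih, kroneckerPow_succ]

variable (b) in
/-- The matrices of the action of the symmetric group on `H^•(X ^ n)`. -/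
noncomputable def permMatrix (n : ℕ) :
    Equiv.Perm (Fin n) →* Matrix (PowerIndex ι n) (PowerIndex ι n) k where
  toFun σ := LinearMap.toMatrix (D.basis b n) (D.basis b n) (totalPullback H (permute X n σ))
  map_one' := by
    rw [permute_one, show totalPullback H (𝟙 (power X n)) = LinearMap.id from
      LinearMap.ext (totalPullback_id H _), LinearMap.toMatrix_id]
  map_mul' σ τ := by
    rw [permute_mul, ← LinearMap.toMatrix_mul]
    congr 1
    exact LinearMap.ext (totalPullback_comp H _ _)

theorem permMatrix_apply (n : ℕ) (σ : Equiv.Perm (Fin n)) : D.permMatrix b n σ =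
    LinearMap.toMatrix (D.basis b n) (D.basis b n) (totalPullback H (permute X n σ)) := rfl

include hb in
theorem isKoszulAction_permMatrix : IsKoszulAction deg (D.permMatrix b) where
  extendLast n τ := by
    rw [permMatrix_apply, D.toMatrix_eq_kron n (D.permute_extendLast_equiv n τ),
      LinearMap.toMatrix_id]
    rfl
  swapLastTwo n := by
    ext p q
    obtain ⟨⟨q, y⟩, rfl⟩ := (PowerIndex.succEquiv ι (n + 1)).surjective q
    obtain ⟨⟨q, x⟩, rfl⟩ := (PowerIndex.succEquiv ι n).surjective q
    obtain ⟨a, ha⟩ := exists_eq_homog hb x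
    obtain ⟨c, hc⟩ := exists_eq_homog hb y
    rw [permMatrix_apply, LinearMap.toMatrix_apply, basis_succ, basis_succ, ha, hc,
      permute_swapLastTwo_equiv, ← ha, ← hc, map_smul, ← basis_succ, ← basis_succ,
      Module.Basis.repr_self, Finsupp.smul_apply, Finsupp.single_apply, powSuperSwap_apply,
      smul_eq_mul, mul_ite, mul_one, mul_zero]
    simp only [eq_comm]

end PowerData

end GradedCohomology

/-! ### Weighted matrices, determinants and Lefschetz series. -/

namespace GradedCohomology

open PowerSeries Matrix

section SigmaBasis

variable {k : Type u} [Field k] (V : GrVec.{u, x} k) [∀ i, FiniteDimensional k (V i)]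

/-- The index type of a homogeneous basis of the total space. -/
abbrev SigmaIndex : Type := Σ i : ℕ, Fin (Module.finrank k (V i))

/-- A homogeneous basis of the total space. -/
noncomputable def sigmaBasis : Module.Basis (SigmaIndex V) k (TotalSpace V) :=
  DFinsupp.basis fun i => Module.finBasis k (V i)

theorem sigmaBasis_repr_homog (i : ℕ) (a : V i) (y : Fin (Module.finrank k (V i))) :
    (sigmaBasis V).repr (homog i a) ⟨i, y⟩ = (Module.finBasis k (V i)).repr a y := by
  change (Module.finBasis k (V i)).repr (DirectSum.component k ℕ (fun i => (V i : Type x)) i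
    (homog i a)) y = _
  rw [DirectSum.component.lof_self]

theorem sigmaBasis_repr_homog_of_ne {i j : ℕ} (h : i ≠ j) (a : V i)
    (y : Fin (Module.finrank k (V j))) : (sigmaBasis V).repr (homog i a) ⟨j, y⟩ = 0 := by
  change (Module.finBasis k (V j)).repr (DirectSum.component k ℕ (fun i => (V i : Type x)) j
    (homog i a)) y = _
  rw [DirectSum.component.of, dif_neg h, map_zero]
  rfl

theorem sigmaBasis_apply (i : ℕ) (y : Fin (Module.finrank k (V i))) :
    sigmaBasis V ⟨i, y⟩ = homog i (Module.finBasis k (V i) y) := by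
  apply (sigmaBasis V).repr.injective
  ext ⟨j, z⟩
  rw [Module.Basis.repr_self]
  by_cases h : i = j
  · subst h
    rw [sigmaBasis_repr_homog, Module.Basis.repr_self, Finsupp.single_apply, Finsupp.single_apply]
    simp
  · rw [sigmaBasis_repr_homog_of_ne V h, Finsupp.single_apply, if_neg]
    rintro ⟨⟩
    exact h rfl

theorem isHomogeneousFamily_sigmaBasis : IsHomogeneousFamily (sigmaBasis V) Sigma.fst := by
  rintro ⟨i, y⟩ j
  rw [sigmaBasis_apply, degreeProj_homog]

variable (φ : V ⟶ V)

/-- The matrix of `φ_i u ^ i`. -/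
noncomputable def degreeMatrix (i : ℕ) :
    Matrix (Fin (Module.finrank k (V i))) (Fin (Module.finrank k (V i))) k⟦X⟧ :=
  (X : k⟦X⟧) ^ i • (LinearMap.toMatrix (Module.finBasis k (V i)) (Module.finBasis k (V i))
    (φ i).hom).map C

theorem detOneSub_eq_det {R : Type u} [CommRing R] [Algebra k R] {W : Type x} [AddCommGroup W]
    [Module k W] {κ : Type*} [Fintype κ] [DecidableEq κ] (b : Module.Basis κ k W) (r : R)
    (ψ : W →ₗ[k] W) :
    detOneSub r ψ = (1 - r • (LinearMap.toMatrix b b ψ).map (algebraMap k R)).det := by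
  let B := Algebra.TensorProduct.basis R b
  have hsub : LinearMap.toMatrix B B (LinearMap.id - r • ψ.baseChange R) =
      LinearMap.toMatrix B B LinearMap.id - LinearMap.toMatrix B B (r • ψ.baseChange R) :=
    map_sub (LinearMap.toMatrix B B) _ _
  rw [detOneSub, ← LinearMap.det_toMatrix B, hsub, map_smul, LinearMap.toMatrix_id,
    show LinearMap.toMatrix B B (ψ.baseChange R) = _ from LinearMap.toMatrix_baseChange R ψ b b]

theorem toSeries_detFactor (i : ℕ) : toSeries k (detFactor i (φ i).hom) =
    (1 - (X : k⟦X⟧⟦X⟧) • (degreeMatrix V φ i).map C).det := by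
  rw [detFactor, detOneSub_eq_det (Module.finBasis k (V i)), RingHom.map_det]
  congr 1
  refine Matrix.ext fun a c => ?_
  simp only [RingHom.mapMatrix_apply, Matrix.map_apply, Matrix.sub_apply, Matrix.smul_apply,
    smul_eq_mul, map_sub, map_mul, degreeMatrix, Matrix.one_apply]
  congr 1
  · split_ifs <;> simp
  · rw [show algebraMap k (Polynomial (Polynomial k)) = Polynomial.C.comp Polynomial.C from rfl]
    simp [toSeries]
    ring

variable [Fintype (SigmaIndex V)]

/-- The matrix of `⨁ i, φ_i u ^ i`. -/
noncomputable def weightedMatrix : Matrix (SigmaIndex V) (SigmaIndex V) k⟦X⟧ :=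
  diagonal (fun x => X ^ x.1) *
    (LinearMap.toMatrix (sigmaBasis V) (sigmaBasis V) (totalMap φ)).map C

theorem toMatrix_sigmaBasis_eq_zero (x y : SigmaIndex V) (h : x.1 ≠ y.1) :
    LinearMap.toMatrix (sigmaBasis V) (sigmaBasis V) (totalMap φ) x y = 0 := by
  rw [LinearMap.toMatrix_apply]
  exact repr_totalMap_eq_zero (isHomogeneousFamily_sigmaBasis V) φ h

theorem weightedMatrix_eq_zero (x y : SigmaIndex V) (h : x.1 ≠ y.1) :
    weightedMatrix V φ x y = 0 := by
  rw [weightedMatrix, Matrix.diagonal_mul, Matrix.map_apply, toMatrix_sigmaBasis_eq_zero V φ x y h,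
    map_zero, mul_zero]

/-- The matrix of φ is block diagonal by degree and the weight is constant on each block, so the two
commute and powers are taken blockwise. -/
theorem weightedMatrix_pow_apply (m i : ℕ) (y : Fin (Module.finrank k (V i))) :
    (weightedMatrix V φ ^ m) ⟨i, y⟩ ⟨i, y⟩ = (degreeMatrix V φ i ^ m) y y := by
  set M := LinearMap.toMatrix (sigmaBasis V) (sigmaBasis V) (totalMap φ) with hM
  set b := Module.finBasis k (V i)
  have hcomm : Commute (diagonal fun x : SigmaIndex V => (X : k⟦X⟧) ^ x.1) (M.map C) := by
    ext x y : 2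
    rw [Matrix.diagonal_mul, Matrix.mul_diagonal, Matrix.map_apply]
    by_cases h : x.1 = y.1
    · rw [h, mul_comm]
    · rw [hM, toMatrix_sigmaBasis_eq_zero V φ x y h, map_zero, mul_zero, zero_mul]
  have hpow : ∀ a : V i, (totalMap φ ^ m) (homog i a) = homog i (((φ i).hom ^ m) a) := by
    intro a
    induction m with
    | zero => rfl
    | succ m ih => rw [pow_succ', pow_succ', Module.End.mul_apply, ih, totalMap_homog]; rfl
  have h1 : (M ^ m) ⟨i, y⟩ ⟨i, y⟩ = (LinearMap.toMatrix b b (φ i).hom ^ m) y y := by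
    have e1 : M ^ m = LinearMap.toMatrix (sigmaBasis V) (sigmaBasis V) (totalMap φ ^ m) :=
      LinearMap.toMatrix_pow _ _ _
    have e2 : LinearMap.toMatrix b b (φ i).hom ^ m = LinearMap.toMatrix b b ((φ i).hom ^ m) :=
      LinearMap.toMatrix_pow _ _ _
    rw [e1, e2, LinearMap.toMatrix_apply, LinearMap.toMatrix_apply, sigmaBasis_apply, hpow,
      sigmaBasis_repr_homog]
  have e1 : M.map C ^ m = (M ^ m).map C :=
    (map_pow (C.mapMatrix : Matrix (SigmaIndex V) (SigmaIndex V) k →+* _) M m).symm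
  have e2 : (LinearMap.toMatrix b b (φ i).hom).map C ^ m =
      (LinearMap.toMatrix b b (φ i).hom ^ m).map C :=
    (map_pow (C.mapMatrix : Matrix (Fin (Module.finrank k (V i))) _ k →+* _) _ m).symm
  rw [weightedMatrix, hcomm.mul_pow, degreeMatrix, smul_pow, Matrix.diagonal_pow,
    Matrix.diagonal_mul, Matrix.smul_apply, e1, e2, Matrix.map_apply, Matrix.map_apply, h1]
  rfl

theorem superTrace_weightedMatrix_pow {N : ℕ} (hN : ∀ i ≥ N, Subsingleton (V i)) (m : ℕ) :
    IsKoszulAction.superTrace Sigma.fst (weightedMatrix V φ ^ m) =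
      ∑ i ∈ Finset.range N, (-1) ^ i * (degreeMatrix V φ i ^ m).trace := by
  have huniv : (Finset.univ : Finset (SigmaIndex V)) =
      (Finset.range N).sigma fun _ => Finset.univ := by
    ext ⟨i, y⟩
    simp only [Finset.mem_univ, Finset.mem_sigma, Finset.mem_range, and_true, true_iff]
    by_contra! h
    have := hN i h
    have h0 : Module.finrank k (V i) = 0 := Module.finrank_zero_of_subsingleton
    exact absurd y.2 (by omega)
  rw [IsKoszulAction.superTrace, Matrix.trace, huniv, Finset.sum_sigma]
  refine Finset.sum_congr rfl fun i _ => ?_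
  rw [Matrix.trace, Finset.mul_sum]
  refine Finset.sum_congr rfl fun y _ => ?_
  rw [Matrix.diag_apply, Matrix.diagonal_mul, weightedMatrix_pow_apply, Matrix.diag_apply]

end SigmaBasis

/-- A finite spanning set involves only finitely many degrees; beyond them every component map
vanishes. -/
theorem exists_subsingleton {k : Type u} [Field k] (V : GrVec.{u, x} k)
    [hV : FiniteDimensional k (TotalSpace V)] : ∃ d : ℕ, ∀ i > 2 * d, Subsingleton (V i) := by
  classical
  obtain ⟨s, hs⟩ := hV.fg_top
  refine ⟨s.sup fun v => (DFinsupp.support v).sup id, fun i hi => ?_⟩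
  have h0 : DirectSum.component k ℕ (fun i => (V i : Type x)) i = 0 := by
    refine LinearMap.ext_on hs fun v hv => ?_
    by_contra hne
    have h1 : i ∈ DFinsupp.support v := DFinsupp.mem_support_iff.2 hne
    have h2 := (Finset.le_sup (f := id) h1).trans
      (Finset.le_sup (f := fun v : TotalSpace V => (DFinsupp.support v).sup id) hv)
    simp only [id] at h2
    omega
  refine ⟨fun a c => ?_⟩
  have h1 : ∀ a : V i, a = 0 := fun a =>
    (DirectSum.component.lof_self k (M := fun i => (V i : Type x)) i a).symm.trans
      (LinearMap.congr_fun h0 _)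
  rw [h1 a, h1 c]

variable {C : Type v} [Category.{w} C] [HasFiniteProducts C] {k : Type u} [Field k]
  {H : Cᵒᵖ ⥤ GrVec.{u, x} k} {μ : CupProduct H} {X : C}

namespace PowerData

/-- The Kronecker power of a degree-preserving matrix commutes with the Koszul action. -/
theorem map_mem_invariants (D : PowerData μ X) [∀ i, FiniteDimensional k (H.obj (op X) i)]
    [Fintype (SigmaIndex (H.obj (op X)))]
    {φ : H.obj (op X) ⟶ H.obj (op X)} {n : ℕ}
    {Φ : H.obj (op (power X n)) ⟶ H.obj (op (power X n))} (hΦ : totalMap Φ = D.endo φ n) (i : ℕ)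
    (y : H.obj (op (power X n)) i) (hy : y ∈ (permRep H X n i).invariants) :
    (Φ i).hom y ∈ (permRep H X n i).invariants := by
  intro σ
  have h1 := (D.isKoszulAction_permMatrix
    (isHomogeneousFamily_sigmaBasis (H.obj (op X)))).commute_kroneckerPow
    (toMatrix_sigmaBasis_eq_zero (H.obj (op X)) φ) n σ
  rw [commute_iff_eq, ← D.toMatrix_endo, permMatrix_apply, ← LinearMap.toMatrix_mul,
    ← LinearMap.toMatrix_mul] at h1
  have h2 := LinearMap.congr_fun ((LinearMap.toMatrix _ _).injective h1)
    (homog (V := H.obj (op (power X n))) i y)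
  rw [Module.End.mul_apply, Module.End.mul_apply, ← hΦ, totalMap_homog, totalPullback_homog,
    totalPullback_homog, totalMap_homog] at h2
  refine (homog_injective _ h2).trans (congrArg (Φ i).hom (hy σ))

theorem factorial_mul_lefschetz (D : PowerData μ X) [CharZero k]
    (hfd : ∀ (Y : C) (i : ℕ), FiniteDimensional k (H.obj (op Y) i))
    [Fintype (SigmaIndex (H.obj (op X)))]
    {φ : H.obj (op X) ⟶ H.obj (op X)} {n : ℕ}
    {Φ : H.obj (op (power X n)) ⟶ H.obj (op (power X n))} (hΦ : totalMap Φ = D.endo φ n)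
    (hinv : ∀ i, ∀ y ∈ (permRep H X n i).invariants,
      (Φ i).hom y ∈ (permRep H X n i).invariants) :
    (n.factorial : k⟦X⟧) * lefschetz (fun i => (Φ i).hom.restrict (hinv i)) =
      IsKoszulAction.symTracePow Sigma.fst
        (fun n => ((PowerSeries.C (R := k)).mapMatrix : Matrix (PowerIndex _ n) (PowerIndex _ n) k →+*
          Matrix _ _ k⟦X⟧).toMonoidHom.comp (D.permMatrix (sigmaBasis (H.obj (op X))) n))
        (weightedMatrix (H.obj (op X)) φ) n := by
  set b := sigmaBasis (H.obj (op X)) with hb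
  have hbh := isHomogeneousFamily_sigmaBasis (H.obj (op X))
  have hK := (D.isKoszulAction_permMatrix hbh).map (PowerSeries.C (R := k))
  have h1 : (n.factorial : k⟦X⟧) * lefschetz (fun i => (Φ i).hom.restrict (hinv i)) =
      ∑ σ : Equiv.Perm (Fin n),
        lefschetz fun i => ((H.map (permute X n σ).op ≫ Φ) i).hom := by
    ext i
    have := hfd (power X n) i
    have h2 := trace_restrict_invariants (permRep H X n i) (Φ i).hom (hinv i)
    rw [Fintype.card_perm, Fintype.card_fin] at h2
    rw [← map_natCast (PowerSeries.C (R := k)), coeff_C_mul, lefschetz, coeff_mk, map_sum,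
      mul_left_comm, h2, Finset.mul_sum]
    refine Finset.sum_congr rfl fun σ _ => ?_
    rw [lefschetz, coeff_mk]
    rfl
  have hW : kroneckerPow (weightedMatrix (H.obj (op X)) φ) n =
      diagonal (fun x => (PowerSeries.X : k⟦X⟧) ^ PowerIndex.degree Sigma.fst n x) *
        (LinearMap.toMatrix (D.basis b n) (D.basis b n) (D.endo φ n)).map (PowerSeries.C (R := k)) := by
    rw [weightedMatrix, kroneckerPow_mul, kroneckerPow_diagonal_pow, D.toMatrix_endo,
      kroneckerPow_map]
  rw [h1, IsKoszulAction.symTracePow, IsKoszulAction.symm, Finset.mul_sum, Finset.sum_mul,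
    Matrix.trace_sum]
  refine Finset.sum_congr rfl fun σ _ => ?_
  -- Commuting the permutation past the Kronecker power puts both sides in the order sign, weight,
  -- φ^{⊗n}, σ, so the diagonal entries can be compared.
  rw [lefschetz_eq_sum (hfd _) (D.isHomogeneousFamily_basis hbh n), mul_assoc,
    (hK.commute_kroneckerPow (weightedMatrix_eq_zero (H.obj (op X)) φ) n σ).eq, hW,
    kroneckerPow_diagonal_pow, totalMap_comp, hΦ, LinearMap.toMatrix_comp _ (D.basis b n)]
  refine Finset.sum_congr rfl fun x _ => ?_
  rw [Matrix.diag_apply, mul_assoc, Matrix.diagonal_mul, Matrix.mul_assoc (diagonal _),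
    Matrix.diagonal_mul]
  congr 2
  exact congrFun₂ (Matrix.map_mul (f := PowerSeries.C (R := k))) x x

end PowerData

end GradedCohomology

/-! ### The generating function. -/

open GradedCohomology
theorem corollary1p4 {C : Type v} [Category.{w} C] [HasFiniteProducts C]
    {k : Type u} [Field k] [CharZero k]
    (H : Cᵒᵖ ⥤ GrVec.{u, x} k)
    (μ : CupProduct H) (hK : μ.Kunneth)
    (hfd : ∀ (Y : C) (i : ℕ), FiniteDimensional k (H.obj (op Y) i))
    (hH : ∃ (Y : C) (i : ℕ), Nontrivial (H.obj (op Y) i))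
    (X : C) (hX : FiniteDimensional k (TotalSpace (H.obj (op X))))
    (φ : H.obj (op X) ⟶ H.obj (op X)) :
    (∀ n : ℕ, ∃! Φ : H.obj (op (power X n)) ⟶ H.obj (op (power X n)),
      μ.IsInduced φ n Φ) ∧
    (∃ d : ℕ, ∀ i > 2 * d, Subsingleton (H.obj (op X) i)) ∧
    ∀ Φ : ∀ n : ℕ, H.obj (op (power X n)) ⟶ H.obj (op (power X n)),
      (∀ n, μ.IsInduced φ n (Φ n)) →
      ∃ hΦ : ∀ n i, ∀ y ∈ (permRep H X n i).invariants,
          (Φ n i).hom y ∈ (permRep H X n i).invariants,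
        (∀ d : ℕ, (∀ i > 2 * d, Subsingleton (H.obj (op X) i)) →
          IsUnit (toSeries k
            (∏ j ∈ Finset.range (d + 1), detFactor (2 * j) (φ (2 * j)).hom)) ∧
          generatingSeries H X Φ hΦ *
              toSeries k
                (∏ j ∈ Finset.range (d + 1), detFactor (2 * j) (φ (2 * j)).hom) =
            toSeries k
              (∏ j ∈ Finset.range d, detFactor (2 * j + 1) (φ (2 * j + 1)).hom)) ∧
        ∃ P Q : Polynomial (Polynomial k), Q.coeff 0 = 1 ∧
          generatingSeries H X Φ hΦ * toSeries k Q =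
            toSeries k P := by
  obtain ⟨D⟩ := hK.nonempty_powerData hH X
  have := hfd X
  have : Fintype (SigmaIndex (H.obj (op X))) :=
    FiniteDimensional.fintypeBasisIndex (sigmaBasis (H.obj (op X)))
  obtain ⟨d₀, hd₀⟩ := exists_subsingleton (H.obj (op X))
  refine ⟨D.existsUnique_isInduced φ, ⟨d₀, hd₀⟩, fun Φ hΦ => ?_⟩
  have htot := fun n => (D.isInduced_iff φ n (Φ n)).1 (hΦ n)
  have hinv := fun n => D.map_mem_invariants (htot n)
  have hconst : ∀ d, PowerSeries.constantCoeff (toSeries k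
      (∏ j ∈ Finset.range (d + 1), detFactor (2 * j) (φ (2 * j)).hom)) = 1 := by
    intro d
    simp only [map_prod, toSeries_detFactor, PowerSeries.constantCoeff_det_one_sub_X_smul,
      Finset.prod_const_one]
  have : CharZero (PowerSeries k) :=
    charZero_of_injective_ringHom (PowerSeries.C_injective (R := k))
  have hlef := fun n => D.factorial_mul_lefschetz hfd (htot n) (hinv n)
  have hKos := (D.isKoszulAction_permMatrix
    (isHomogeneousFamily_sigmaBasis (H.obj (op X)))).map (PowerSeries.C (R := k))
  have main : ∀ d : ℕ, (∀ i > 2 * d, Subsingleton (H.obj (op X) i)) →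
      generatingSeries H X Φ hinv *
        toSeries k (∏ j ∈ Finset.range (d + 1), detFactor (2 * j) (φ (2 * j)).hom) =
      toSeries k (∏ j ∈ Finset.range d, detFactor (2 * j + 1) (φ (2 * j + 1)).hom) := by
    intro d hd
    simp only [map_prod, toSeries_detFactor]
    -- Two obligations remain: constant term 1, which is the case n = 0, and the differential
    -- equation, which is Newton's identities coefficient by coefficient.
    refine PowerSeries.mul_prod_det_eq_prod_det (degreeMatrix (H.obj (op X)) φ) d ?_ ?_
    · have h0 := hlef 0
      rw [IsKoszulAction.symTracePow_zero, Nat.factorial_zero, Nat.cast_one, one_mul] at h0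
      rw [generatingSeries, ← PowerSeries.coeff_zero_eq_constantCoeff_apply, PowerSeries.coeff_mk]
      exact h0
    · ext1 n
      rw [PowerSeries.coeff_derivative, PowerSeries.coeff_mul, generatingSeries,
        PowerSeries.coeff_mk,
        hKos.succ_mul_eq_sum (weightedMatrix_eq_zero (H.obj (op X)) φ) hlef n]
      refine Finset.sum_congr rfl fun p _ => ?_
      rw [PowerSeries.coeff_mk, PowerSeries.coeff_mk,
        -- Vanishing above degree 2d truncates the supertrace to the degrees 0, …, 2d.
        superTrace_weightedMatrix_pow (N := 2 * d + 1) _ φ fun i hi => hd i (by omega)]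
  -- P and Q are the products of the odd and of the even determinants for `d₀`.
  refine ⟨hinv, fun d hd => ⟨?_, main d hd⟩, _, _, ?_, main d₀ hd₀⟩
  · rw [PowerSeries.isUnit_iff_constantCoeff, hconst]
    exact isUnit_one
  -- The constant term in t is known to be 1 in k⟦u⟧; injectivity of k[u] → k⟦u⟧ carries this back
  -- to Q.
  · apply Polynomial.coe_injective k
    have h := hconst d₀
    generalize (∏ j ∈ Finset.range (d₀ + 1), detFactor (2 * j) (φ (2 * j)).hom) = Q at h ⊢
    rw [toSeries, RingHom.comp_apply, Polynomial.coeToPowerSeries.ringHom_apply,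
      Polynomial.constantCoeff_coe] at h
    simpa using h
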